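/- Let $p>q$ be primes, $g\ge 1$ an integer, $n=gq+1$, and let $e$ be the order of $p$ modulo $q$. Assume $p^e>n$ and $p\ge n+q-2$. For $s\ge 1$ put $$\Phi_s(t,z)=\big((t-z_1)\cdots(t-z_n)\big)^{(p^{es}-1)/q}\in\mathbb Z[z_1,\dots,z_n][t].$$ Let $A(\Phi_s)(z)$ be the $g\times g$ matrix whose $(u,v)$ entry, $1\le u,v\le g$, is the coefficient of $t^{vp^{es}-u}$ in $\Phi_s(t,z)$, and let $I_s(z)$ be the $n\times g$ matrix whose $(i,\ell)$ entry is the coefficient of $t^{\ell p^{es}-1}$ in $\Phi_s(t,z)/(t-z_i)$. For an $n\times g$ matrix $B$ denote by $\mu(B)$ its $g\times g$ minor in the rows with indices $q(g-\ell)+1$, $\ell=1,\dots,g$. Let $M(z)=\mu(I_1(z))$, and let $d_\Phi$ and $d_M$ be the degrees of the polynomials $\det A(\Phi_1)(z)$ and $M(z)$. For $m\ge 1$ let $\mathbb Q_p^{(m)}$ be the unramified extension of $\mathbb Q_p$ of degree $m$, with the norm $|\cdot|_p$ normalized by $|p|_p=1/p$ and the ring of integers $\mathbb Z_p^{(m)}$.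 Let $$\mathfrak D^{(m)}_{\mathrm{KZ}}=\{a\in(\mathbb Z_p^{(m)})^n:\ |\det A(\Phi_1)(a)|_p=1\},\qquad \mathfrak D^{(m),o}_{\mathrm{KZ}}=\{a\in\mathfrak D^{(m)}_{\mathrm{KZ}}:\ a_i\ne a_j \text{ for } i\neq j\},$$ and let $W\subset(\mathbb Q_p^{(m)})^n$ be the subspace of vectors with zero sum of coordinates. **Theorem.** Assume $p^m>d_\Phi+d_M$. Then: 1. The sequence of matrices $I_s(a)\,A(\Phi_s)(a)^{-1}$ converges as $s\to\infty$, uniformly on $\mathfrak D^{(m)}_{\mathrm{KZ}}$, to an $n\times g$ matrix $\mathcal I(a)$. The entries of $\mathcal I$ are analytic on $\mathfrak D^{(m)}_{\mathrm{KZ}}$: on each open unit polydisc contained in $\mathfrak D^{(m)}_{\mathrm{KZ}}$ they are given by a power series convergent on that polydisc. 2. The subspaces $\mathcal L_a\subset(\mathbb Q_p^{(m)})^n$ spanned by the columns of $\mathcal I(a)$, $a\in\mathfrak D^{(m),o}_{\mathrm{KZ}}$, are contained in $W$ and form an analytic vector bundle of rank $g$ over $\mathfrak D^{(m),o}_{\mathrm{KZ}}$: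 $\dim\mathcal L_a=g$ for every $a\in\mathfrak D^{(m),o}_{\mathrm{KZ}}$, and near each point of $\mathfrak D^{(m),o}_{\mathrm{KZ}}$ the family $\mathcal L$ has a frame of $g$ analytic sections. 3. For every $a\in\mathfrak D^{(m)}_{\mathrm{KZ}}$ one has $\mu(\mathcal I(a))\equiv\mu\big(I_1(a)A(\Phi_1)(a)^{-1}\big)\pmod p$, and the function $a\mapsto\mu(\mathcal I(a))$ is not identically zero modulo $p$ on $\mathfrak D^{(m),o}_{\mathrm{KZ}}$: $|\mu(\mathcal I(a))|_p=1$ for some $a\in\mathfrak D^{(m),o}_{\mathrm{KZ}}$. In particular $\mathfrak D^{(m),o}_{\mathrm{KZ}}$ is nonempty. -/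

import Mathlib

open Filter Topology

noncomputable section

namespace PadicKZ

/-! ### Unramified extensions of the field of `p`-adic numbers -/

/-- The unramified extension of `ℚ_[p]` of degree `m` inside a fixed algebraic closure, obtained
by attaching the primitive roots of unity of order `p ^ m - 1` (for `m ≥ 1`). -/
def unramifiedField (p m : ℕ) [Fact p.Prime] : IntermediateField ℚ_[p] (PadicAlgCl p) :=
  IntermediateField.adjoin ℚ_[p] {ζ : PadicAlgCl p | IsPrimitiveRoot ζ (p ^ m - 1)}

/-- The unramified extension as a type; it carries the norm of the algebraic closure, which
extends the norm of `ℚ_[p]` (so `‖p‖ = 1 / p`). -/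
abbrev Unr (p m : ℕ) [Fact p.Prime] : Type := ↥(unramifiedField p m)

instance unrNontriviallyNormedField (p m : ℕ) [Fact p.Prime] :
    NontriviallyNormedField (Unr p m) where
  __ := (inferInstance : NormedField (Unr p m))
  non_trivial := by
    obtain ⟨x, hx⟩ := NormedField.exists_one_lt_norm ℚ_[p]
    refine ⟨algebraMap ℚ_[p] (Unr p m) x, ?_⟩
    have h : ‖algebraMap ℚ_[p] (Unr p m) x‖ = ‖x‖ := PadicAlgCl.norm_extends p x
    rw [h]
    exact hx

/-! ### Master polynomials, solutions modulo powers of `p`, Hasse-Witt matrices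

The variables `z_1, …, z_n`, with `n = g * q + 1`, are indexed by `Fin (g * q + 1)`, starting from
zero; the columns `ℓ = 1, …, g` are indexed by `Fin g`, so that `ℓ` is `(l : ℕ) + 1`. -/

/-- The order `e` of `p` modulo `q`. -/
def ord (p q : ℕ) : ℕ := orderOf (p : ZMod q)

/-- The master polynomial `Φ_s(t, z) = ((t - z_1) ⋯ (t - z_n)) ^ ((p ^ (e * s) - 1) / q)`, as a
polynomial in `t` with coefficients in `ℤ[z]`; the division in the exponent is exact. -/
def master (p q g s : ℕ) : Polynomial (MvPolynomial (Fin (g * q + 1)) ℤ) :=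
  (∏ i : Fin (g * q + 1), (Polynomial.X - Polynomial.C (MvPolynomial.X i))) ^
    ((p ^ (ord p q * s) - 1) / q)

/-- The `n × g` matrix `I_s(z)`: the entry in row `i` and column `ℓ` is the coefficient of
`t ^ (ℓ * p ^ (e * s) - 1)` in `Φ_s(t, z) / (t - z_i)` (an exact division for `s ≥ 1`). -/
def solMatrix (p q g s : ℕ) :
    Matrix (Fin (g * q + 1)) (Fin g) (MvPolynomial (Fin (g * q + 1)) ℤ) :=
  Matrix.of fun i l =>
    (master p q g s /ₘ (Polynomial.X - Polynomial.C (MvPolynomial.X i))).coeff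
      (((l : ℕ) + 1) * p ^ (ord p q * s) - 1)

/-- The Hasse-Witt matrix `A(Φ_s)`: the entry `(u, v)`, where `1 ≤ u, v ≤ g`, is the coefficient
of `t ^ (p ^ (e * s) * v - u)` in `Φ_s(t, z)`. -/
def hasseWitt (p q g s : ℕ) :
    Matrix (Fin g) (Fin g) (MvPolynomial (Fin (g * q + 1)) ℤ) :=
  Matrix.of fun u v =>
    (master p q g s).coeff (p ^ (ord p q * s) * ((v : ℕ) + 1) - ((u : ℕ) + 1))

/-- The row with (one-based) index `q * (g - ℓ) + 1`, for `ℓ = 1, …, g`. -/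
def minorRow (q g : ℕ) (l : Fin g) : Fin (g * q + 1) :=
  ⟨q * (g - ((l : ℕ) + 1)), Nat.lt_succ_of_le
    (by rw [Nat.mul_comm g q]; exact Nat.mul_le_mul_left q (Nat.sub_le _ _))⟩

/-- The `g × g` minor of an `n × g` matrix in the rows `q * (g - ℓ) + 1`, `ℓ = 1, …, g`. -/
def rowMinor {R : Type*} [CommRing R] (q g : ℕ) (B : Matrix (Fin (g * q + 1)) (Fin g) R) : R :=
  (B.submatrix (minorRow q g) id).det

/-- The degree `d_Φ` of the polynomial `det A(Φ_1)`. -/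
def degPhi (p q g : ℕ) : ℕ := (hasseWitt p q g 1).det.totalDegree

/-- The degree `d_M` of the polynomial `M(z)`, the above minor of `I_1(z)`. -/
def degM (p q g : ℕ) : ℕ := (rowMinor q g (solMatrix p q g 1)).totalDegree

/-! ### The domains, the limit matrix and the distribution -/

section

variable (p q g m : ℕ) [Fact p.Prime]

/-- The space in which `z = (z_1, …, z_n)` varies, with the maximum norm. -/
abbrev Space : Type := Fin (g * q + 1) → Unr p m

/-- The value at a point `a` of the matrix `A(Φ_s)`. -/
def hasseWittAt (s : ℕ) (a : Space p q g m) : Matrix (Fin g) (Fin g) (Unr p m) :=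
  (hasseWitt p q g s).map (MvPolynomial.aeval a)

/-- The value at a point `a` of the matrix `I_s`. -/
def solMatrixAt (s : ℕ) (a : Space p q g m) : Matrix (Fin (g * q + 1)) (Fin g) (Unr p m) :=
  (solMatrix p q g s).map (MvPolynomial.aeval a)

/-- The domain of points with integral coordinates at which `det A(Φ_1)` has norm one. -/
def domain : Set (Space p q g m) :=
  {a | (∀ i, ‖a i‖ ≤ 1) ∧ ‖(hasseWittAt p q g m 1 a).det‖ = 1}

/-- The part of the domain outside the diagonal hyperplanes. -/
def domainO : Set (Space p q g m) :=
  {a | a ∈ domain p q g m ∧ ∀ i j, i ≠ j → a i ≠ a j}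

/-- The matrix `I_s(a) * A(Φ_s)(a)⁻¹`. -/
def approxMatrix (s : ℕ) (a : Space p q g m) : Matrix (Fin (g * q + 1)) (Fin g) (Unr p m) :=
  solMatrixAt p q g m s a * (hasseWittAt p q g m s a)⁻¹

/-- The `p`-adic limit `𝓘(a)` of the matrices `I_s(a) * A(Φ_s)(a)⁻¹` as `s → ∞`. -/
def limitMatrix (a : Space p q g m) : Matrix (Fin (g * q + 1)) (Fin g) (Unr p m) :=
  Matrix.of fun i l => limUnder atTop fun s : ℕ => approxMatrix p q g m s a i l

/-- The fiber `W` of the trivial bundle: the vectors with zero sum of coordinates. -/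
def zeroSum : Submodule (Unr p m) (Space p q g m) where
  carrier := {x | ∑ i, x i = 0}
  zero_mem' := by simp
  add_mem' := by
    intro x y hx hy
    simp only [Set.mem_ofPred_eq] at hx hy ⊢
    simp [Finset.sum_add_distrib, hx, hy]
  smul_mem' := by
    intro c x hx
    simp only [Set.mem_ofPred_eq] at hx ⊢
    simp [← Finset.mul_sum, hx]

/-- The subspace `𝓛_a` spanned by the columns of the matrix `𝓘(a)`. -/
def distribution (a : Space p q g m) : Submodule (Unr p m) (Space p q g m) :=
  Submodule.span (Unr p m) (Set.range fun l : Fin g => (limitMatrix p q g m a).col l)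

end

/-! ### Analytic functions and analytic vector bundles -/

/-- A function is analytic on a union `D` of open polydiscs of radius one if on each of these
polydiscs it is the sum of a power series that converges on the whole polydisc. -/
def AnalyticOnPolydiscs {K E F : Type*} [NontriviallyNormedField K] [NormedAddCommGroup E]
    [NormedSpace K E] [NormedAddCommGroup F] [NormedSpace K F] (f : E → F) (D : Set E) : Prop :=
  ∀ a ∈ D, ∃ P : FormalMultilinearSeries K E F, HasFPowerSeriesOnBall f P a 1

/-- A family `L` of subspaces of `W`, indexed by the points of `D`, is an analytic vector bundle
of rank `r` over `D` (a subbundle of the trivial bundle `W × D`): all its members have dimension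
`r`, and near every point of `D` it has a frame that consists of `r` analytic sections. -/
structure IsAnalyticBundle {K E V : Type*} [NontriviallyNormedField K] [NormedAddCommGroup E]
    [NormedSpace K E] [NormedAddCommGroup V] [NormedSpace K V] (W : Submodule K V) (D : Set E)
    (L : E → Submodule K V) (r : ℕ) : Prop where
  le : ∀ a ∈ D, L a ≤ W
  rank : ∀ a ∈ D, Module.finrank K (L a) = r
  frame : ∀ a ∈ D, ∃ U : Set E, IsOpen U ∧ a ∈ U ∧ ∃ f : Fin r → E → V,
    (∀ j, AnalyticOnNhd K (f j) U) ∧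
    ∀ b ∈ U ∩ D, LinearIndependent K (fun j => f j b) ∧
      Submodule.span K (Set.range fun j => f j b) = L b

end PadicKZ

end

/-!
Let `Q = p ^ e`. Differentiating shows that `M` divides `k` times the coefficient of `t ^ k` in an
`M`-th power, so the coefficients of `Φ_1 ^ Q ^ s` at exponents not divisible by high powers of `Q`
are highly divisible by `p`. As `Φ_{s+1} = Φ_s * Φ_1 ^ Q ^ s`, congruences modulo `p ^ j`, `j ≤ s`,
between the rows of coefficients of `Φ_j / (t - z_i)` and of `Φ_j` persist for the index `s + 1`
modulo `p ^ s`; therefore consecutive matrices `I_s * A(Φ_s)⁻¹` agree modulo `p ^ s`. The inverses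
exist wherever `det A(Φ_1)` is a unit, because modulo `p` the matrix `A(Φ_{s+1})` is the product of
`A(Φ_1)` and a Frobenius twist of `A(Φ_s)`.

All this works over any `p`-adically complete ring. Over the ring of integers it gives uniform
convergence; over the ring of formal power series around an integral point it gives a limit with
integral coefficients, which converges on the open unit polydisc and specializes to `𝓘`.

The exponent of `Φ_s` is `-1 / q` modulo `Q ^ s`, and the derivative of `t ^ u * Φ_s` has
coefficients divisible by `Q ^ s` at the degrees `ℓ * Q ^ s - 1`. Expanding it gives a relation
`powerSumMatrix * A(Φ_s) ≡ powerMatrix * I_s`, in the limit `powerSumMatrix = powerMatrix * 𝓘`,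
whose left-hand side is triangular with the diagonal entries `q * u - n = -(q * (g - u) + 1)`. Hence
the columns of `𝓘` are independent; the case `u = 0` says that they have zero sum.

At a point of characteristic `p` whose coordinates fall into `g` clusters of `q` equal ones, one of
the clusters at `0`, and one further coordinate, the same relation shows that the minor `μ(I_1)`
does not vanish if `det A(Φ_1)` does not. Such a point with `det A(Φ_1) ≠ 0` is found cluster by
cluster. So `det A(Φ_1) * M` does not vanish identically modulo `p`, and `p ^ m` residues are enough
to find a point where it does not vanish.
-/

noncomputable section

namespace PadicKZ

section Divisibility

open Polynomial

variable {R : Type*} {p : ℕ}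

theorem exists_pow_dvd_and_not_pow_succ_dvd (Q k s : ℕ) :
    ∃ w ≤ s, Q ^ w ∣ k ∧ (w = s ∨ ¬ Q ^ (w + 1) ∣ k) := by
  induction s with
  | zero => exact ⟨0, le_rfl, by simp, Or.inl rfl⟩
  | succ s ih =>
    obtain ⟨w, hws, hwk, rfl | hw⟩ := ih
    · by_cases h : Q ^ (w + 1) ∣ k
      · exact ⟨w + 1, le_rfl, h, Or.inl rfl⟩
      · exact ⟨w, w.le_succ, hwk, Or.inr h⟩
    · exact ⟨w, hws.trans s.le_succ, hwk, Or.inr hw⟩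

theorem natCast_dvd_natCast_mul_coeff_pow [CommSemiring R] (f : R[X]) (M k : ℕ) :
    (M : R) ∣ (k : R) * (f ^ M).coeff k := by
  rcases k with _ | k
  · simp
  have h := coeff_derivative (f ^ M) k
  rw [derivative_pow, mul_assoc, coeff_C_mul] at h
  exact ⟨_, by push_cast; rw [mul_comm, ← h]⟩

variable [CommRing R]

theorem pow_dvd_of_pow_dvd_natCast_mul (hp : p.Prime) (hreg : (p : R) ∈ nonZeroDivisors R)
    {a b k : ℕ} {c : R} (hk : ¬ p ^ (b + 1) ∣ k) (h : (p : R) ^ a ∣ (k : R) * c) :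
    (p : R) ^ (a - b) ∣ c := by
  have hk0 : k ≠ 0 := by rintro rfl; exact hk (dvd_zero _)
  obtain ⟨v, k', hk', rfl⟩ := Nat.exists_eq_pow_mul_and_not_dvd hk0 p hp.ne_one
  have hvb : v ≤ b := by
    by_contra! hbv
    exact hk ((pow_dvd_pow p hbv).mul_right k')
  refine (pow_dvd_pow _ (Nat.sub_le_sub_left hvb a)).trans ?_
  rcases le_total a v with hav | hva
  · simp [Nat.sub_eq_zero_of_le hav]
  have hcancel : (p : R) ^ (a - v) ∣ (k' : R) * c := by
    obtain ⟨d, hd⟩ := h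
    refine ⟨d, ?_⟩
    rw [← mul_cancel_left_mem_nonZeroDivisors (pow_mem hreg v), ← mul_assoc, ← mul_assoc,
      ← pow_add, Nat.add_sub_cancel' hva, ← hd]
    push_cast
    ring
  have hcoprime : IsCoprime ((p : R) ^ (a - v)) (k' : R) := by
    refine IsCoprime.pow_left ?_
    simpa using (Nat.isCoprime_iff_coprime.2 (hp.coprime_iff_not_dvd.2 hk')).map
      (Int.castRingHom R)
  exact hcoprime.dvd_of_dvd_mul_left hcancel

theorem pow_dvd_coeff_pow_of_not_dvd (hp : p.Prime) (hreg : (p : R) ∈ nonZeroDivisors R)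
    {e w k : ℕ} (hk : ¬ (p ^ e) ^ (w + 1) ∣ k) (f : R[X]) (s : ℕ) :
    (p : R) ^ (s - w) ∣ (f ^ (p ^ e) ^ s).coeff k := by
  have he : 0 < e := by
    rw [Nat.pos_iff_ne_zero]
    rintro rfl
    exact hk (by simp)
  obtain ⟨b, hb : e * (w + 1) = b + 1⟩ :=
    Nat.exists_eq_succ_of_ne_zero (Nat.mul_pos he w.succ_pos).ne'
  have hkb : ¬ p ^ (b + 1) ∣ k := by rwa [← hb, pow_mul]
  have hdvd := natCast_dvd_natCast_mul_coeff_pow f ((p ^ e) ^ s) k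
  rw [← pow_mul, Nat.cast_pow] at hdvd
  rw [← pow_mul]
  refine (pow_dvd_pow _ ?_).trans (pow_dvd_of_pow_dvd_natCast_mul hp hreg hkb hdvd)
  rcases le_or_gt s w with hsw | hws
  · simp [Nat.sub_eq_zero_of_le hsw]
  · obtain ⟨d, rfl⟩ := Nat.exists_eq_add_of_lt hws
    have hd : d ≤ e * d := Nat.le_mul_of_pos_left d he
    rw [show e * (w + d + 1) = b + 1 + e * d by rw [← hb]; ring]
    omega

/-- The coefficients of `H` at the multiples of `Q ^ i` are divisible by `p ^ i` for `i ≤ s`. For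
`Q` a power of `p` this is what multiplication by a power `f ^ Q ^ s` preserves, and hence the
inductive hypothesis behind Dwork's congruences. -/
def CoeffPowDvd (p Q s : ℕ) (H : R[X]) : Prop :=
  ∀ i ≤ s, ∀ k, Q ^ i ∣ k → (p : R) ^ i ∣ H.coeff k

theorem CoeffPowDvd.mul_pow (hp : p.Prime) (hreg : (p : R) ∈ nonZeroDivisors R) {e s : ℕ}
    {H : R[X]} (hH : CoeffPowDvd p (p ^ e) s H) (f : R[X]) :
    CoeffPowDvd p (p ^ e) s (H * f ^ (p ^ e) ^ s) := by
  intro i hi n hn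
  rw [coeff_mul]
  refine Finset.dvd_sum fun ⟨a, k⟩ hak => ?_
  obtain rfl : a + k = n := Finset.HasAntidiagonal.mem_antidiagonal.1 hak
  obtain ⟨w, hws, hwk, hw⟩ := exists_pow_dvd_and_not_pow_succ_dvd (p ^ e) k s
  have hHa : (p : R) ^ min i w ∣ H.coeff a := by
    have hmin : (p ^ e) ^ min i w ∣ k := (pow_dvd_pow _ (min_le_right _ _)).trans hwk
    exact hH _ ((min_le_left _ _).trans hi) _
      ((Nat.dvd_add_left hmin).1 ((pow_dvd_pow _ (min_le_left _ _)).trans hn))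
  have hfk : (p : R) ^ (s - w) ∣ (f ^ (p ^ e) ^ s).coeff k := by
    rcases hw with rfl | hw
    · simp
    · exact pow_dvd_coeff_pow_of_not_dvd hp hreg hw f s
  refine dvd_trans ?_ (mul_dvd_mul hHa hfk)
  rw [← pow_add]
  exact pow_dvd_pow _ (by omega)

theorem pow_dvd_coeff_succ (hp : p.Prime) (hreg : (p : R) ∈ nonZeroDivisors R) {e s : ℕ}
    {H : ℕ → R[X]} {f : R[X]} (hsucc : ∀ j, 0 < j → H (j + 1) = H j * f ^ (p ^ e) ^ j)
    (hH : ∀ j ≤ s, ∀ k, (p ^ e) ^ j ∣ k → (p : R) ^ j ∣ (H j).coeff k) {k : ℕ}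
    (hk : (p ^ e) ^ s ∣ k) : (p : R) ^ s ∣ (H (s + 1)).coeff k := by
  have hcoeff : ∀ j ≤ s, CoeffPowDvd p (p ^ e) j (H (j + 1)) := by
    intro j
    induction j with
    | zero =>
      rintro - i hi n -
      simp [Nat.le_zero.1 hi]
    | succ j ih =>
      intro hj
      rw [hsucc (j + 1) j.succ_pos]
      refine CoeffPowDvd.mul_pow hp hreg (fun i hi n hn => ?_) f
      rcases hi.eq_or_lt with rfl | hi
      · exact hH _ hj n hn
      · exact ih (j.le_succ.trans hj) i (Nat.lt_succ_iff.1 hi) n hn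
  exact hcoeff s le_rfl s le_rfl k hk

end Divisibility

section DworkCongruence

open Polynomial
open scoped Matrix

variable {R : Type*} [CommRing R] {Q g : ℕ} {f h : R[X]}

/-- The Hasse-Witt matrix of `f` with respect to `Q`: the entry `(u, v)`, with one-based indices,
is the coefficient of `t ^ (Q * v - u)` in `f`. -/
def coeffMatrix (Q g : ℕ) (f : R[X]) : Matrix (Fin g) (Fin g) R :=
  Matrix.of fun u v => f.coeff (Q * (v + 1) - (u + 1))

/-- The row of the coefficients of `t ^ (Q * l - 1)`, `l = 1, …, g`, in `h`. -/
def coeffRow (Q g : ℕ) (h : R[X]) : Fin g → R :=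
  fun l => h.coeff (Q * (l + 1) - 1)

/-- The row vector `t` with `t * A = r`, where `A` is the Hasse-Witt matrix of `f` and `r` the row
of coefficients of `h`; meaningful only if `A` is invertible. -/
def coeffQuotient (Q g : ℕ) (h f : R[X]) : Fin g → R :=
  coeffRow Q g h ᵥ* (coeffMatrix Q g f)⁻¹

theorem coeffQuotient_vecMul (hf : IsUnit (coeffMatrix Q g f).det) (h : R[X]) :
    coeffQuotient Q g h f ᵥ* coeffMatrix Q g f = coeffRow Q g h := by
  rw [coeffQuotient, Matrix.vecMul_vecMul, Matrix.nonsing_inv_mul _ hf, Matrix.vecMul_one]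

/-- The polynomial whose coefficients at `Q, 2 * Q, …, g * Q` are the entries of the row
`r - T * A`, where `A` is the Hasse-Witt matrix of `f` and `r` the row of coefficients of `h`. -/
def residual (h f : R[X]) (T : Fin g → R) : R[X] :=
  X * h - ∑ u : Fin g, C (T u) * (X ^ ((u : ℕ) + 1) * f)

theorem coeff_residual (hg : g ≤ Q) (h f : R[X]) (T : Fin g → R) (l : Fin g) :
    (residual h f T).coeff (Q * (l + 1)) =
      (coeffRow Q g h - T ᵥ* coeffMatrix Q g f) l := by
  have hle : Q ≤ Q * (l + 1) := Nat.le_mul_of_pos_right _ l.succ_pos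
  have hX : (X * h).coeff (Q * (l + 1)) = coeffRow Q g h l := by
    obtain ⟨d, hd⟩ := Nat.exists_eq_succ_of_ne_zero (l.pos.trans_le (hg.trans hle)).ne'
    rw [coeffRow, hd, Nat.succ_eq_add_one, coeff_X_mul, Nat.add_sub_cancel]
  rw [residual, coeff_sub, hX, finsetSum_coeff]
  refine congrArg _ (Finset.sum_congr rfl fun u _ => ?_)
  rw [coeff_C_mul, coeff_X_pow_mul', if_pos (by omega)]
  rfl

theorem coeff_X_pow_mul_eq_zero (hf : f.natDegree + g < (g + 1) * Q) (u : Fin g) {m : ℕ}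
    (hm : ∀ l : Fin g, m ≠ l + 1) : (X ^ ((u : ℕ) + 1) * f).coeff (Q * m) = 0 := by
  rcases Nat.eq_zero_or_pos m with rfl | hm0
  · simp
  have hgm : g + 1 ≤ m := by
    by_contra! hlt
    exact hm ⟨m - 1, by omega⟩ (by simp; omega)
  have hQm : (g + 1) * Q ≤ Q * m := by rw [mul_comm]; exact Nat.mul_le_mul_left Q hgm
  rw [coeff_X_pow_mul', if_pos (by omega), coeff_eq_zero_of_natDegree_lt (by omega)]

theorem dvd_coeff_residual (hg0 : 0 < g) (hg : g ≤ Q) (hh : h.natDegree + g < (g + 1) * Q)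
    (hf : f.natDegree + g < (g + 1) * Q) {T : Fin g → R} {d : R}
    (hd : ∀ l, d ∣ (coeffRow Q g h - T ᵥ* coeffMatrix Q g f) l) {k : ℕ} (hk : Q ∣ k) :
    d ∣ (residual h f T).coeff k := by
  obtain ⟨m, rfl⟩ := hk
  by_cases hm : ∃ l : Fin g, m = l + 1
  · obtain ⟨l, rfl⟩ := hm
    rw [coeff_residual hg]
    exact hd l
  · push Not at hm
    have hXh : (X * h).coeff (Q * m) = 0 := by
      rw [← coeff_X_pow_mul_eq_zero hh ⟨0, hg0⟩ hm, zero_add, pow_one]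
    rw [residual, coeff_sub, hXh, finsetSum_coeff, Finset.sum_eq_zero, sub_zero]
    · exact dvd_zero d
    · intro u _
      rw [coeff_C_mul, coeff_X_pow_mul_eq_zero hf u hm, mul_zero]

theorem residual_mul (h f φ : R[X]) (T : Fin g → R) :
    residual (h * φ) (f * φ) T = residual h f T * φ := by
  simp only [residual, sub_mul, Finset.sum_mul, mul_assoc]

theorem dvd_vecMul {m n : Type*} [Fintype m] {d : R} {v : m → R} (hv : ∀ i, d ∣ v i)
    (M : Matrix m n R) (j : n) : d ∣ (v ᵥ* M) j :=
  Finset.dvd_sum fun i _ => (hv i).mul_right _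

theorem pow_dvd_sub_of_le {d : R} {x : ℕ → R} {a b : ℕ} (hab : a ≤ b)
    (hx : ∀ s, a ≤ s → s < b → d ^ s ∣ x (s + 1) - x s) : d ^ a ∣ x b - x a := by
  induction b, hab using Nat.le_induction with
  | base => simp
  | succ b hab ih =>
    rw [← sub_add_sub_cancel (x (b + 1)) (x b)]
    exact dvd_add ((pow_dvd_pow d hab).trans (hx b hab b.lt_succ_self))
      (ih fun s has hsb => hx s has (hsb.trans b.lt_succ_self))

/-- A sequence of polynomials `f 1, f 2, …` with `f (s + 1) = f s * φ ^ Q ^ s` that satisfies the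
bound on the degrees under which only the coefficients at `Q ^ s, …, g * Q ^ s` matter. The term
`f 0` is irrelevant. -/
structure IsDworkSequence (Q g : ℕ) (φ : R[X]) (f : ℕ → R[X]) : Prop where
  succ : ∀ s, 0 < s → f (s + 1) = f s * φ ^ Q ^ s
  natDegree_lt : ∀ s, 0 < s → (f s).natDegree + g < (g + 1) * Q ^ s

variable {p e : ℕ} {φ : R[X]} {f h : ℕ → R[X]}

theorem pow_dvd_coeffRow_sub_succ (hp : p.Prime) (hreg : (p : R) ∈ nonZeroDivisors R)
    (hg : g ≤ p ^ e) (hh : IsDworkSequence (p ^ e) g φ h) (hf : IsDworkSequence (p ^ e) g φ f)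
    {T : Fin g → R} {s : ℕ}
    (hT : ∀ j, 0 < j → j ≤ s → ∀ l, (p : R) ^ j ∣
      (coeffRow ((p ^ e) ^ j) g (h j) - T ᵥ* coeffMatrix ((p ^ e) ^ j) g (f j)) l) (l : Fin g) :
    (p : R) ^ s ∣ (coeffRow ((p ^ e) ^ (s + 1)) g (h (s + 1)) -
      T ᵥ* coeffMatrix ((p ^ e) ^ (s + 1)) g (f (s + 1))) l := by
  have hgpow : ∀ j, 0 < j → g ≤ (p ^ e) ^ j := fun j hj => hg.trans (Nat.le_self_pow hj.ne' _)
  rw [← coeff_residual (hgpow _ s.succ_pos)]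
  refine pow_dvd_coeff_succ (H := fun j => residual (h j) (f j) T) (f := φ) (e := e) hp hreg
    (fun j hj => ?_) (fun j hjs k hk => ?_) ?_
  · rw [hh.succ j hj, hf.succ j hj, residual_mul]
  · rcases Nat.eq_zero_or_pos j with rfl | hj
    · simp
    · exact dvd_coeff_residual l.pos (hgpow j hj) (hh.natDegree_lt j hj) (hf.natDegree_lt j hj)
        (hT j hj hjs) hk
  · exact (pow_dvd_pow _ s.le_succ).mul_right _

theorem pow_dvd_coeffQuotient_succ_sub (hp : p.Prime) (hreg : (p : R) ∈ nonZeroDivisors R)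
    (hg : g ≤ p ^ e) (hh : IsDworkSequence (p ^ e) g φ h) (hf : IsDworkSequence (p ^ e) g φ f)
    (hdet : ∀ s, 0 < s → IsUnit (coeffMatrix ((p ^ e) ^ s) g (f s)).det) {s : ℕ} (hs : 0 < s)
    (l : Fin g) :
    (p : R) ^ s ∣ coeffQuotient ((p ^ e) ^ (s + 1)) g (h (s + 1)) (f (s + 1)) l -
      coeffQuotient ((p ^ e) ^ s) g (h s) (f s) l := by
  induction s using Nat.strong_induction_on generalizing l with
  | _ s ih =>
    set t : ℕ → Fin g → R := fun j => coeffQuotient ((p ^ e) ^ j) g (h j) (f j)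
    set A : ℕ → Matrix (Fin g) (Fin g) R := fun j => coeffMatrix ((p ^ e) ^ j) g (f j)
    have hrow : ∀ j, 0 < j → coeffRow ((p ^ e) ^ j) g (h j) - t s ᵥ* A j = (t j - t s) ᵥ* A j :=
      fun j hj => by rw [Matrix.sub_vecMul, coeffQuotient_vecMul (hdet j hj)]
    have hnext : ∀ l, (p : R) ^ s ∣ ((t (s + 1) - t s) ᵥ* A (s + 1)) l := by
      intro l
      rw [← hrow _ s.succ_pos]
      refine pow_dvd_coeffRow_sub_succ hp hreg hg hh hf (fun j hj hjs l => ?_) l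
      rw [hrow j hj]
      refine dvd_vecMul (fun u => ?_) _ _
      rw [Pi.sub_apply, dvd_sub_comm]
      exact pow_dvd_sub_of_le (x := fun r => t r u) hjs
        fun r hjr hrs => ih r hrs (hj.trans_le hjr) u
    have hinv : t (s + 1) - t s = ((t (s + 1) - t s) ᵥ* A (s + 1)) ᵥ* (A (s + 1))⁻¹ := by
      rw [Matrix.vecMul_vecMul, Matrix.mul_nonsing_inv _ (hdet _ s.succ_pos), Matrix.vecMul_one]
    rw [← Pi.sub_apply, hinv]
    exact dvd_vecMul hnext _ l

end DworkCongruence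

section Frobenius

open Polynomial

variable {R : Type*} [CommRing R] {Q Q' g : ℕ} {f : R[X]}

theorem contract_X_pow_mul (hg : g ≤ Q) (hf : f.natDegree + g < (g + 1) * Q) (u : Fin g) :
    contract Q (X ^ ((u : ℕ) + 1) * f) =
      ∑ k : Fin g, C (coeffMatrix Q g f u k) * X ^ ((k : ℕ) + 1) := by
  ext m
  rw [coeff_contract (u.pos.trans_le hg).ne', mul_comm m, finsetSum_coeff]
  simp only [coeff_C_mul, coeff_X_pow, mul_ite, mul_one, mul_zero]
  by_cases hm : ∃ k : Fin g, m = k + 1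
  · obtain ⟨k, rfl⟩ := hm
    have hle : Q ≤ Q * (k + 1) := Nat.le_mul_of_pos_right _ k.succ_pos
    rw [Finset.sum_eq_single k (fun j _ hj => if_neg fun h => hj (Fin.ext (by omega))) (by simp),
      if_pos rfl, coeff_X_pow_mul', if_pos (by omega), coeffMatrix, Matrix.of_apply]
  · push Not at hm
    rw [coeff_X_pow_mul_eq_zero hf u hm, Finset.sum_eq_zero fun k _ => if_neg (hm k)]

theorem coeffMatrix_mul_expand (hg : g ≤ Q) (hg' : g ≤ Q')
    (hf : f.natDegree + g < (g + 1) * Q) (f' : R[X]) :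
    coeffMatrix (Q * Q') g (f * expand R Q f') = coeffMatrix Q g f * coeffMatrix Q' g f' := by
  ext u v
  have hQ : 0 < Q := u.pos.trans_le hg
  have hv : Q' ≤ Q' * (v + 1) := Nat.le_mul_of_pos_right _ v.succ_pos
  have hv' : Q' * (v + 1) ≤ Q' * (v + 1) * Q := Nat.le_mul_of_pos_right _ hQ
  calc coeffMatrix (Q * Q') g (f * expand R Q f') u v
      = (contract Q (X ^ ((u : ℕ) + 1) * f * expand R Q f')).coeff (Q' * (v + 1)) := by
        rw [coeff_contract hQ.ne', mul_assoc (X ^ ((u : ℕ) + 1)), coeff_X_pow_mul',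
          if_pos (by omega), coeffMatrix, Matrix.of_apply, mul_comm (Q' * _) Q, mul_assoc Q]
    _ = ∑ k, coeffMatrix Q g f u k * coeffMatrix Q' g f' k v := by
        rw [contract_mul_expand hQ.ne', contract_X_pow_mul hg hf, Finset.sum_mul,
          finsetSum_coeff]
        refine Finset.sum_congr rfl fun k _ => ?_
        rw [mul_assoc, coeff_C_mul, coeff_X_pow_mul', if_pos (by omega)]
        rfl

theorem coeffMatrix_mul_pow {p e : ℕ} [ExpChar R p] (hg : g ≤ p ^ e) (hg' : g ≤ Q')
    (hf : f.natDegree + g < (g + 1) * p ^ e) (f' : R[X]) :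
    coeffMatrix (p ^ e * Q') g (f * f' ^ p ^ e) =
      coeffMatrix (p ^ e) g f * (iterateFrobenius R p e).mapMatrix (coeffMatrix Q' g f') := by
  rw [← map_iterateFrobenius_expand, map_expand, coeffMatrix_mul_expand hg hg' hf]
  congr 1
  ext u v
  simp [coeffMatrix]

theorem isUnit_det_coeffMatrix_of_expChar {p e : ℕ} [ExpChar R p] (hg : g ≤ p ^ e)
    {f : ℕ → R[X]} (hf : (f 1).natDegree + g < (g + 1) * p ^ e)
    (hsucc : ∀ s, 0 < s → f (s + 1) = f 1 * f s ^ p ^ e)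
    (hdet : IsUnit (coeffMatrix (p ^ e) g (f 1)).det) {s : ℕ} (hs : 0 < s) :
    IsUnit (coeffMatrix ((p ^ e) ^ s) g (f s)).det := by
  induction s, hs using Nat.le_induction with
  | base => rwa [pow_one]
  | succ s hs ih =>
    have hgpow : g ≤ (p ^ e) ^ s := hg.trans (Nat.le_self_pow (Nat.pos_iff_ne_zero.1 hs) _)
    rw [hsucc s hs, pow_succ', coeffMatrix_mul_pow hg hgpow hf, Matrix.det_mul,
      ← RingHom.map_det]
    exact hdet.mul (ih.map _)

end Frobenius

section PowerSums

open Polynomial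
open Lagrange (nodal)

variable {R ι : Type*} [CommRing R] [Fintype ι] {q N Q M g : ℕ}

/-- The lower triangular matrix of power sums of the `z i` that carries, modulo `q * N + 1`, the
Hasse-Witt matrix of `(∏ i, (t - z i)) ^ N` to the combinations, with coefficients in
`powerMatrix`, of the rows of coefficients of the `nodalPowQuot z N i`. -/
def powerSumMatrix (q g : ℕ) (z : ι → R) : Matrix (Fin g) (Fin g) R :=
  Matrix.of fun u j => (if j = u then (q : R) * (u + 1) else 0) -
    if j ≤ u then ∑ i, z i ^ ((u : ℕ) - j) else 0

/-- The matrix with rows `(z i ^ u)_i` for `u = 1, …, g`. -/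
def powerMatrix (g : ℕ) (z : ι → R) : Matrix (Fin g) ι R :=
  Matrix.of fun u i => z i ^ ((u : ℕ) + 1)

theorem det_powerSumMatrix (q g : ℕ) (z : ι → R) :
    (powerSumMatrix q g z).det = ∏ u : Fin g, ((q : R) * (u + 1) - Fintype.card ι) := by
  rw [Matrix.det_of_isLowerTriangular]
  · refine Finset.prod_congr rfl fun u _ => ?_
    simp [powerSumMatrix]
  · intro u j (huj : u < j)
    simp [powerSumMatrix, huj.ne', not_le.2 huj]

theorem powerSumMatrix_mul_apply (q : ℕ) (z : ι → R) {A : Matrix (Fin g) (Fin g) R} {b : ℕ → R}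
    {v : Fin g} (hA : ∀ j, A j v = b j) (u : Fin g) :
    (powerSumMatrix q g z * A) u v =
      q * (u + 1) * b u - ∑ j ∈ Finset.range (u + 1), (∑ i, z i ^ ((u : ℕ) - j)) * b j := by
  have hrange : (Finset.range g).filter (· ≤ (u : ℕ)) = Finset.range (u + 1) := by
    ext j
    simp
    omega
  rw [← hrange, Finset.sum_filter, ← Fin.sum_univ_eq_sum_range, Matrix.mul_apply]
  simp only [powerSumMatrix, Matrix.of_apply, hA, sub_mul, Finset.sum_sub_distrib, ite_mul,
    zero_mul, Finset.sum_ite_eq', Finset.mem_univ, if_true, Fin.le_def]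

variable [DecidableEq ι]

/-- The quotient of `(∏ j, (t - z j)) ^ N` by `t - z i`, for `N > 0`. -/
def nodalPowQuot (z : ι → R) (N : ℕ) (i : ι) : R[X] :=
  nodal (Finset.univ.erase i) z * nodal Finset.univ z ^ (N - 1)

theorem X_sub_C_mul_nodalPowQuot (hN : 0 < N) (z : ι → R) (i : ι) :
    (X - C (z i)) * nodalPowQuot z N i = nodal Finset.univ z ^ N := by
  rw [nodalPowQuot, ← mul_assoc, ← Lagrange.nodal_eq_mul_nodal_erase (Finset.mem_univ i),
    ← pow_succ', Nat.sub_add_cancel hN]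

theorem X_pow_mul_nodalPowQuot (hN : 0 < N) (z : ι → R) (k : ℕ) (i : ι) :
    X ^ k * nodalPowQuot z N i = C (z i ^ k) * nodalPowQuot z N i +
      ∑ j ∈ Finset.range k, C (z i ^ (k - 1 - j)) * (X ^ j * nodal Finset.univ z ^ N) := by
  have hgeom := (Commute.all (X : R[X]) (C (z i))).geom_sum₂_mul k
  have hsum : ∑ j ∈ Finset.range k, C (z i ^ (k - 1 - j)) * (X ^ j * nodal Finset.univ z ^ N) =
      (∑ j ∈ Finset.range k, X ^ j * C (z i) ^ (k - 1 - j)) * (X - C (z i)) *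
        nodalPowQuot z N i := by
    rw [mul_assoc, X_sub_C_mul_nodalPowQuot hN, Finset.sum_mul]
    refine Finset.sum_congr rfl fun j _ => ?_
    rw [C_pow]
    ring
  rw [hsum, hgeom, C_pow]
  ring

theorem X_pow_mul_nodal_pow_mul_derivative (hN : 0 < N) (z : ι → R) (k : ℕ) :
    X ^ k * (nodal Finset.univ z ^ (N - 1) * derivative (nodal Finset.univ z)) =
      ∑ i, C (z i ^ k) * nodalPowQuot z N i +
        ∑ j ∈ Finset.range k,
          C (∑ i, z i ^ (k - 1 - j)) * (X ^ j * nodal Finset.univ z ^ N) := by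
  simp only [map_sum, Finset.sum_mul]
  rw [Finset.sum_comm, ← Finset.sum_add_distrib, Lagrange.derivative_nodal, Finset.mul_sum,
    Finset.mul_sum]
  refine Finset.sum_congr rfl fun i _ => ?_
  rw [← X_pow_mul_nodalPowQuot hN, nodalPowQuot]
  ring

theorem dvd_coeff_nodal_pow_sub (hQ : q * N + 1 = Q) (hN : 0 < N) (hM : Q ∣ M + 1) (z : ι → R)
    (k : ℕ) :
    (Q : R) ∣ q * k * (X ^ (k - 1) * nodal Finset.univ z ^ N).coeff M -
      ∑ j ∈ Finset.range k, (∑ i, z i ^ (k - 1 - j)) * (X ^ j * nodal Finset.univ z ^ N).coeff M -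
      ∑ i, z i ^ k * (nodalPowQuot z N i).coeff M := by
  set F := nodal Finset.univ z
  have hderiv : (q : R[X]) * derivative (X ^ k * F ^ N) =
      C (q * k : R) * (X ^ (k - 1) * F ^ N) +
        C (q * N : R) * (X ^ k * (F ^ (N - 1) * derivative F)) := by
    rw [derivative_mul, derivative_pow, derivative_pow, derivative_X]
    simp only [map_mul, map_natCast]
    ring
  rw [X_pow_mul_nodal_pow_mul_derivative hN] at hderiv
  have hcoeff := congrArg (coeff · M) hderiv
  simp only [← C_eq_natCast, coeff_C_mul, coeff_add, coeff_derivative, finsetSum_coeff] at hcoeff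
  have hqN : (q * N : R) = Q - 1 := by
    rw [← hQ]
    push_cast
    ring
  obtain ⟨d, hd⟩ := hM
  have hMd : (M : R) + 1 = Q * d := by exact_mod_cast congrArg (Nat.cast (R := R)) hd
  rw [hqN, hMd] at hcoeff
  set S := ∑ i, z i ^ k * (nodalPowQuot z N i).coeff M
  set U := ∑ j ∈ Finset.range k, (∑ i, z i ^ (k - 1 - j)) * (X ^ j * F ^ N).coeff M
  exact ⟨q * ((X ^ k * F ^ N).coeff (M + 1) * d) - S - U, by linear_combination -hcoeff⟩

theorem natCast_dvd_powerSumMatrix_mul_sub (hQ : q * N + 1 = Q) (hN : 0 < N) (hg : g ≤ Q)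
    (z : ι → R) (u l : Fin g) :
    (Q : R) ∣ (powerSumMatrix q g z * coeffMatrix Q g (nodal Finset.univ z ^ N) -
      powerMatrix g z * Matrix.of fun i => coeffRow Q g (nodalPowQuot z N i)) u l := by
  have hl : Q ≤ Q * (l + 1) := Nat.le_mul_of_pos_right _ l.succ_pos
  have hdvd := dvd_coeff_nodal_pow_sub (M := Q * (l + 1) - 1) hQ hN
    (by rw [Nat.sub_add_cancel (by omega)]; exact dvd_mul_right _ _) z (u + 1)
  convert hdvd using 1
  rw [Matrix.sub_apply, powerSumMatrix_mul_apply q z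
    (b := fun j => (X ^ j * nodal Finset.univ z ^ N).coeff (Q * (l + 1) - 1))]
  · simp [Matrix.mul_apply, powerMatrix, coeffRow]
  · intro j
    rw [coeff_X_pow_mul', if_pos (by omega), Nat.sub_sub, add_comm 1]
    rfl

theorem natCast_dvd_sum_coeffRow_nodalPowQuot (hQ : q * N + 1 = Q) (hN : 0 < N) (z : ι → R)
    (l : Fin g) : (Q : R) ∣ ∑ i, coeffRow Q g (nodalPowQuot z N i) l := by
  have hl : Q ≤ Q * (l + 1) := Nat.le_mul_of_pos_right _ l.succ_pos
  simpa [coeffRow] using dvd_coeff_nodal_pow_sub (M := Q * (l + 1) - 1) hQ hN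
    (by rw [Nat.sub_add_cancel (by omega)]; exact dvd_mul_right _ _) z 0

end PowerSums

section Specialization

open Polynomial
open Lagrange (nodal)

/-- The exponent of the master polynomial `Φ_s`; the division is exact if `p` is prime to `q`. -/
def expo (p q s : ℕ) : ℕ := (p ^ (ord p q * s) - 1) / q

variable {p q : ℕ}

theorem mul_expo_add_one (hp : p.Prime) (s : ℕ) : q * expo p q s + 1 = (p ^ ord p q) ^ s := by
  have hdvd : q ∣ p ^ (ord p q * s) - 1 := by
    rw [← ZMod.natCast_eq_zero_iff, Nat.cast_sub (Nat.one_le_pow _ _ hp.pos), Nat.cast_pow,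
      pow_mul, ord, pow_orderOf_eq_one]
    simp
  rw [expo, Nat.mul_div_cancel' hdvd, Nat.sub_add_cancel (Nat.one_le_pow _ _ hp.pos), pow_mul]

variable (hp : p.Prime) (hpq : p.Coprime q)
include hp hpq

theorem pos_of_coprime : 0 < q := by
  rw [Nat.pos_iff_ne_zero]
  rintro rfl
  exact hp.ne_one ((Nat.coprime_zero_right p).1 hpq)

theorem ord_pos : 0 < ord p q := by
  have := NeZero.of_pos (pos_of_coprime hp hpq)
  rwa [ord, orderOf_pos_iff, isOfFinOrder_iff_isUnit, ZMod.isUnit_iff_coprime]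

theorem le_pow_ord {g : ℕ} (hdvd : ∀ d < g, ¬p ∣ q * d + 1) : g ≤ p ^ ord p q := by
  by_contra! hlt
  have hle : expo p q 1 ≤ q * expo p q 1 := Nat.le_mul_of_pos_left _ (pos_of_coprime hp hpq)
  have hexpo : q * expo p q 1 + 1 = p ^ ord p q := by rw [mul_expo_add_one hp, pow_one]
  exact hdvd (expo p q 1) (by lia) (hexpo ▸ dvd_pow_self p (ord_pos hp hpq).ne')

theorem expo_pos {s : ℕ} (hs : 0 < s) : 0 < expo p q s := by
  have hQ : 1 < (p ^ ord p q) ^ s :=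
    Nat.one_lt_pow hs.ne' (Nat.one_lt_pow (ord_pos hp hpq).ne' hp.one_lt)
  rw [← mul_expo_add_one hp] at hQ
  exact Nat.pos_of_mul_pos_left (Nat.lt_of_succ_lt_succ hQ)

theorem expo_add (s t : ℕ) :
    expo p q (s + t) = expo p q s + expo p q t * (p ^ ord p q) ^ s := by
  refine Nat.eq_of_mul_eq_mul_left (pos_of_coprime hp hpq) (Nat.add_right_cancel (m := 1) ?_)
  calc q * expo p q (s + t) + 1 = (p ^ ord p q) ^ s * (q * expo p q t + 1) := by
        rw [mul_expo_add_one hp, mul_expo_add_one hp, pow_add]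
    _ = q * expo p q t * (p ^ ord p q) ^ s + (q * expo p q s + 1) := by
        rw [mul_expo_add_one hp s]
        ring
    _ = q * (expo p q s + expo p q t * (p ^ ord p q) ^ s) + 1 := by ring

omit hp hpq

variable {R S : Type*} [CommRing R] [CommRing S] {g s : ℕ}

/-- The matrix `A(Φ_s)` at a point with coordinates in a commutative ring. -/
def hasseWittEval (p q g s : ℕ) (z : Fin (g * q + 1) → R) : Matrix (Fin g) (Fin g) R :=
  coeffMatrix ((p ^ ord p q) ^ s) g (nodal Finset.univ z ^ expo p q s)

/-- The matrix `I_s`, `s > 0`, at a point with coordinates in a commutative ring. -/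
def solEval (p q g s : ℕ) (z : Fin (g * q + 1) → R) : Matrix (Fin (g * q + 1)) (Fin g) R :=
  Matrix.of fun i => coeffRow ((p ^ ord p q) ^ s) g (nodalPowQuot z (expo p q s) i)

theorem map_rowMinor (φ : R →+* S) (q g : ℕ) (B : Matrix (Fin (g * q + 1)) (Fin g) R) :
    φ (rowMinor q g B) = rowMinor q g (B.map φ) := by
  rw [rowMinor, RingHom.map_det, RingHom.mapMatrix_apply, rowMinor, Matrix.submatrix_map]

theorem rowMinor_mul (q g : ℕ) (B : Matrix (Fin (g * q + 1)) (Fin g) R)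
    (A : Matrix (Fin g) (Fin g) R) : rowMinor q g (B * A) = rowMinor q g B * A.det := by
  rw [rowMinor, rowMinor, ← Matrix.det_mul]
  rfl

theorem map_nodal {ι : Type*} (φ : R →+* S) (t : Finset ι) (z : ι → R) :
    (nodal t z).map φ = nodal t (φ ∘ z) := by
  simp [nodal, Polynomial.map_prod]

theorem map_hasseWittEval (φ : R →+* S) (p q g s : ℕ) (z : Fin (g * q + 1) → R) :
    (hasseWittEval p q g s z).map φ = hasseWittEval p q g s (φ ∘ z) := by
  ext u v
  simp [hasseWittEval, coeffMatrix, ← map_nodal, ← Polynomial.map_pow, coeff_map]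

theorem map_solEval (φ : R →+* S) (p q g s : ℕ) (z : Fin (g * q + 1) → R) :
    (solEval p q g s z).map φ = solEval p q g s (φ ∘ z) := by
  ext i l
  simp [solEval, coeffRow, nodalPowQuot, ← map_nodal, ← Polynomial.map_pow, ← Polynomial.map_mul,
    coeff_map]

theorem hasseWittEval_X (p q g s : ℕ) :
    hasseWittEval p q g s MvPolynomial.X = hasseWitt p q g s := by
  ext1 u v
  rw [hasseWittEval, ← pow_mul]
  rfl

theorem solEval_X (hp : p.Prime) (hpq : p.Coprime q) (g : ℕ) (hs : 0 < s) :
    solEval p q g s MvPolynomial.X = solMatrix p q g s := by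
  ext1 i l
  have hmaster : master p q g s = (X - C (MvPolynomial.X i)) *
      nodalPowQuot MvPolynomial.X (expo p q s) i :=
    (X_sub_C_mul_nodalPowQuot (expo_pos hp hpq hs) _ _).symm
  rw [solEval, solMatrix, Matrix.of_apply, Matrix.of_apply, hmaster,
    mul_divByMonic_cancel_left _ (monic_X_sub_C _), mul_comm ((l : ℕ) + 1), pow_mul p, coeffRow]

theorem map_aeval_hasseWitt [Algebra ℤ R] (p q g s : ℕ) (z : Fin (g * q + 1) → R) :
    (hasseWitt p q g s).map (MvPolynomial.aeval z) = hasseWittEval p q g s z := by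
  rw [← hasseWittEval_X]
  refine (map_hasseWittEval (S := R) (MvPolynomial.aeval (R := ℤ) z).toRingHom p q g s _).trans ?_
  congr 1
  ext i
  simp

theorem map_aeval_solMatrix [Algebra ℤ R] (hp : p.Prime) (hpq : p.Coprime q) (hs : 0 < s)
    (z : Fin (g * q + 1) → R) :
    (solMatrix p q g s).map (MvPolynomial.aeval z) = solEval p q g s z := by
  rw [← solEval_X hp hpq g hs]
  refine (map_solEval (S := R) (MvPolynomial.aeval (R := ℤ) z).toRingHom p q g s _).trans ?_
  congr 1
  ext i
  simp

section

variable (hp : p.Prime) (hpq : p.Coprime q)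
include hp hpq

theorem natDegree_nodal_pow_expo_lt (z : Fin (g * q + 1) → R) (s : ℕ) :
    (nodal Finset.univ z ^ expo p q s).natDegree + g < (g + 1) * (p ^ ord p q) ^ s := by
  have hdeg : (nodal Finset.univ z ^ expo p q s).natDegree ≤ expo p q s * (g * q + 1) := by
    nontriviality R
    simpa using natDegree_pow_le (p := nodal Finset.univ z) (n := expo p q s)
  have hle : expo p q s ≤ q * expo p q s := Nat.le_mul_of_pos_left _ (pos_of_coprime hp hpq)
  rw [← mul_expo_add_one hp]
  nlinarith

theorem isDworkSequence_nodal_pow_expo (z : Fin (g * q + 1) → R) :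
    IsDworkSequence (p ^ ord p q) g (nodal Finset.univ z ^ expo p q 1)
      (fun s => nodal Finset.univ z ^ expo p q s) where
  succ s _ := by rw [expo_add hp hpq, pow_add, pow_mul]
  natDegree_lt s _ := natDegree_nodal_pow_expo_lt hp hpq z s

theorem isDworkSequence_nodalPowQuot (z : Fin (g * q + 1) → R) (i : Fin (g * q + 1)) :
    IsDworkSequence (p ^ ord p q) g (nodal Finset.univ z ^ expo p q 1)
      (fun s => nodalPowQuot z (expo p q s) i) where
  succ s hs := by
    have hexpo : expo p q (s + 1) - 1 = expo p q s - 1 + expo p q 1 * (p ^ ord p q) ^ s := by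
      rw [expo_add hp hpq, Nat.sub_add_comm (expo_pos hp hpq hs)]
    rw [nodalPowQuot, hexpo, pow_add, pow_mul, nodalPowQuot, mul_assoc]
  natDegree_lt s hs := by
    refine lt_of_le_of_lt (Nat.add_le_add_right ?_ g) (natDegree_nodal_pow_expo_lt hp hpq z s)
    rw [← X_sub_C_mul_nodalPowQuot (expo_pos hp hpq hs) z i]
    nontriviality R
    have hmonic : (nodalPowQuot z (expo p q s) i).Monic :=
      (Lagrange.nodal_monic ..).mul ((Lagrange.nodal_monic ..).pow _)
    rw [(monic_X_sub_C _).natDegree_mul hmonic]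
    exact Nat.le_add_left _ _

theorem isUnit_det_hasseWittEval_of_expChar [ExpChar R p] (hg : g ≤ p ^ ord p q)
    {z : Fin (g * q + 1) → R} (hz : IsUnit (hasseWittEval p q g 1 z).det) (hs : 0 < s) :
    IsUnit (hasseWittEval p q g s z).det := by
  refine isUnit_det_coeffMatrix_of_expChar (f := fun s => nodal Finset.univ z ^ expo p q s) hg
    ?_ (fun s _ => ?_) ?_ hs
  · simpa using natDegree_nodal_pow_expo_lt hp hpq z 1
  · rw [add_comm s 1, expo_add hp hpq, pow_add, pow_mul, pow_one]
  · simpa [hasseWittEval] using hz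

theorem pow_dvd_powerSumMatrix_mul_sub (hg : g ≤ p ^ ord p q) (s : ℕ)
    (z : Fin (g * q + 1) → R) (u l : Fin g) :
    (p : R) ^ s ∣ (powerSumMatrix q g z * hasseWittEval p q g s z -
      powerMatrix g z * solEval p q g s z) u l := by
  rcases s.eq_zero_or_pos with rfl | hs
  · simp
  refine dvd_trans ?_ (natCast_dvd_powerSumMatrix_mul_sub (mul_expo_add_one hp s)
    (expo_pos hp hpq hs) (hg.trans (Nat.le_self_pow hs.ne' _)) z u l)
  push_cast
  exact pow_dvd_pow_of_dvd (dvd_pow_self _ (ord_pos hp hpq).ne') s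

theorem pow_dvd_sum_solEval (s : ℕ) (z : Fin (g * q + 1) → R) (l : Fin g) :
    (p : R) ^ s ∣ ∑ i, solEval p q g s z i l := by
  rcases s.eq_zero_or_pos with rfl | hs
  · simp
  refine dvd_trans ?_ (natCast_dvd_sum_coeffRow_nodalPowQuot (mul_expo_add_one hp s)
    (expo_pos hp hpq hs) z l)
  push_cast
  exact pow_dvd_pow_of_dvd (dvd_pow_self _ (ord_pos hp hpq).ne') s

end

/-- The matrix `I_s * A(Φ_s)⁻¹` at a point with coordinates in a commutative ring; meaningful only
if `A(Φ_s)` is invertible there. -/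
def approxEval (p q g s : ℕ) (z : Fin (g * q + 1) → R) : Matrix (Fin (g * q + 1)) (Fin g) R :=
  solEval p q g s z * (hasseWittEval p q g s z)⁻¹

theorem approxEval_mul {z : Fin (g * q + 1) → R} (h : IsUnit (hasseWittEval p q g s z).det) :
    approxEval p q g s z * hasseWittEval p q g s z = solEval p q g s z := by
  rw [approxEval, Matrix.nonsing_inv_mul_cancel_right _ _ h]

theorem map_approxEval (φ : R →+* S) {z : Fin (g * q + 1) → R}
    (h : IsUnit (hasseWittEval p q g s z).det) :
    (approxEval p q g s z).map φ = approxEval p q g s (φ ∘ z) := by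
  have hS : IsUnit (hasseWittEval p q g s (φ ∘ z)).det := by
    rw [← map_hasseWittEval, ← RingHom.mapMatrix_apply, ← RingHom.map_det]
    exact h.map φ
  rw [approxEval.eq_def p q g s (φ ∘ z), ← map_solEval, ← approxEval_mul h, Matrix.map_mul,
    map_hasseWittEval, Matrix.mul_nonsing_inv_cancel_right _ _ hS]

theorem pow_dvd_approxEval_succ_sub (hp : p.Prime) (hpq : p.Coprime q) (hg : g ≤ p ^ ord p q)
    (hreg : (p : R) ∈ nonZeroDivisors R) {z : Fin (g * q + 1) → R}
    (hz : ∀ s, 0 < s → IsUnit (hasseWittEval p q g s z).det) (s : ℕ)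
    (i : Fin (g * q + 1)) (l : Fin g) :
    (p : R) ^ s ∣ approxEval p q g (s + 1) z i l - approxEval p q g s z i l := by
  rcases s.eq_zero_or_pos with rfl | hs
  · simp
  · exact pow_dvd_coeffQuotient_succ_sub hp hreg hg (isDworkSequence_nodalPowQuot hp hpq z i)
      (isDworkSequence_nodal_pow_expo hp hpq z) hz hs l

end Specialization

section Nonvanishing

open Polynomial
open Lagrange (nodal)

theorem det_coeffMatrix_succ {R : Type*} [CommRing R] {Q r : ℕ} (hQ : 0 < Q) {h : R[X]}
    (hmonic : h.Monic) (hdeg : h.natDegree = (r + 1) * (Q - 1)) :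
    (coeffMatrix Q (r + 1) h).det = (coeffMatrix Q r h).det := by
  have hindex (u : Fin (r + 1)) : Q * (r + 1) - (u + 1) = h.natDegree + (r - u) := by
    obtain ⟨Q, rfl⟩ := Nat.exists_eq_add_of_le' hQ
    have hu := u.is_le
    have hexp : (Q + 1) * (r + 1) = (r + 1) * Q + (r + 1) := by ring
    simp only [hdeg, hexp, Nat.add_sub_cancel]
    omega
  have hlast (u : Fin (r + 1)) :
      coeffMatrix Q (r + 1) h u (Fin.last r) = if u = Fin.last r then 1 else 0 := by
    rw [coeffMatrix, Matrix.of_apply, Fin.val_last, hindex]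
    split_ifs with hu
    · rw [hu, Fin.val_last, Nat.sub_self, add_zero, hmonic.coeff_natDegree]
    · have := Fin.val_lt_last hu
      exact coeff_eq_zero_of_natDegree_lt (by omega)
  rw [Matrix.det_succ_column _ (Fin.last r), Finset.sum_eq_single_of_mem _ (Finset.mem_univ _)
    fun u _ hu => by rw [hlast, if_neg hu, mul_zero, zero_mul]]
  rw [hlast, if_pos rfl, Fin.val_last, Even.neg_one_pow ⟨r, rfl⟩, one_mul, one_mul,
    Fin.succAbove_last]
  rfl

theorem exists_det_coeffMatrix_mul_ne_zero {K : Type*} [Field K] [Infinite K] {Q r : ℕ} {h : K[X]}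
    (hh : (coeffMatrix Q r h).det ≠ 0) (N : ℕ) :
    ∃ y : K, (coeffMatrix Q r (h * (X - C y) ^ N)).det ≠ 0 := by
  let D : K[X] := (coeffMatrix Q r (h.map C * (1 - C X * X) ^ N)).det
  have hD (t : K) : D.eval t = (coeffMatrix Q r (h * (1 - C t * X) ^ N)).det := by
    have hmap : (h.map C * (1 - C X * X) ^ N).map (evalRingHom t) = h * (1 - C t * X) ^ N := by
      have hid : (evalRingHom t).comp C = RingHom.id K := by ext; simp
      simp [Polynomial.map_map, hid]
    rw [← coe_evalRingHom, RingHom.map_det, ← hmap]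
    congr 1
    ext u v
    simp only [coeffMatrix, Matrix.of_apply, RingHom.mapMatrix_apply, Matrix.map_apply, coeff_map]
  have hXD : X * D ≠ 0 := by
    refine mul_ne_zero X_ne_zero fun h0 => hh ?_
    simpa [h0] using (hD 0).symm
  obtain ⟨t, ht⟩ : ∃ t, (X * D).eval t ≠ 0 := by
    by_contra! hzero
    exact hXD (Polynomial.funext fun t => by simp [hzero t])
  rw [eval_mul, eval_X, hD] at ht
  have ht0 : t ≠ 0 := left_ne_zero_of_mul ht
  have hrescale : (1 - C t * X : K[X]) = C (-t) * (X - C t⁻¹) := by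
    rw [mul_sub, ← C_mul, neg_mul, mul_inv_cancel₀ ht0, C_neg, C_neg, C_1]
    ring
  have hsmul : coeffMatrix Q r (h * (1 - C t * X) ^ N) =
      (-t) ^ N • coeffMatrix Q r (h * (X - C t⁻¹) ^ N) := by
    rw [hrescale, mul_pow, ← C_pow, mul_left_comm]
    ext u v
    simp only [coeffMatrix, Matrix.of_apply, coeff_C_mul, Matrix.smul_apply, smul_eq_mul]
  refine ⟨t⁻¹, fun h0 => right_ne_zero_of_mul ht ?_⟩
  rw [hsmul, Matrix.det_smul, h0, mul_zero]

theorem exists_det_coeffMatrix_prod_mul_ne_zero (K : Type*) [Field K] [Infinite K] {Q : ℕ}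
    (hQ : 0 < Q) (r N : ℕ) : ∃ w : ℕ → K, w 0 = 0 ∧ (coeffMatrix Q r
      ((∏ j ∈ Finset.range r, (X - C (w j)) ^ (Q - 1)) * (X - C (w r)) ^ N)).det ≠ 0 := by
  induction r generalizing N with
  | zero => exact ⟨0, rfl, by simp⟩
  | succ r ih =>
    obtain ⟨w, hw0, hw⟩ := ih (Q - 1)
    rw [← Finset.prod_range_succ (fun j => (X - C (w j)) ^ (Q - 1))] at hw
    have hmonic (j : ℕ) : ((X - C (w j)) ^ (Q - 1)).Monic := (monic_X_sub_C _).pow _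
    rw [← det_coeffMatrix_succ hQ (monic_prod_of_monic _ _ fun j _ => hmonic j)
      (by simp [natDegree_prod_of_monic _ _ fun j _ => hmonic j])] at hw
    obtain ⟨y, hy⟩ := exists_det_coeffMatrix_mul_ne_zero hw N
    refine ⟨Function.update w (r + 1) y, by simp [hw0], ?_⟩
    rw [Function.update_self, Finset.prod_congr rfl fun j hj => by
      rw [Function.update_of_ne (Finset.mem_range.1 hj).ne]]
    exact hy

theorem prod_range_mul_div {M : Type*} [CommMonoid M] {q : ℕ} (hq : 0 < q) (g : ℕ) (f : ℕ → M) :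
    ∏ i ∈ Finset.range (g * q), f (i / q) = ∏ a ∈ Finset.range g, f a ^ q := by
  induction g with
  | zero => simp
  | succ g ih =>
    have hdiv : ∀ i ∈ Finset.range q, f ((g * q + i) / q) = f g := fun i hi => by
      rw [mul_comm, Nat.mul_add_div hq, Nat.div_eq_of_lt (Finset.mem_range.1 hi), add_zero]
    rw [Nat.succ_mul, Finset.prod_range_add, ih, Finset.prod_range_succ,
      Finset.prod_congr rfl hdiv, Finset.prod_const, Finset.card_range]

/-- The coordinates of the point where the minor is shown not to vanish fall into clusters of equal
ones; this is the number of the cluster of a coordinate. The cluster `g` consists of the first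
coordinate alone, the cluster `ℓ < g` of the `q` coordinates that follow the index
`q * (g - ℓ - 1)`. -/
def cluster (q g : ℕ) (i : Fin (g * q + 1)) : ℕ := g - ((i : ℕ) + q - 1) / q

theorem cluster_minorRow {q g : ℕ} (hq : 0 < q) (l : Fin g) :
    cluster q g (minorRow q g l) = l + 1 := by
  have hl := l.2
  rw [cluster, minorRow]
  dsimp only
  rw [Nat.add_sub_assoc hq, Nat.mul_add_div hq, Nat.div_eq_of_lt (by omega)]
  omega

theorem nodal_cluster {R : Type*} [CommRing R] {q : ℕ} (hq : 0 < q) (g : ℕ) (w : ℕ → R) :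
    nodal Finset.univ (w ∘ cluster q g) =
      (∏ j ∈ Finset.range g, (X - C (w j)) ^ q) * (X - C (w g)) := by
  have hzero : cluster q g 0 = g := by
    simp [cluster, Nat.div_eq_of_lt (Nat.sub_lt hq one_pos)]
  have hsucc (i : Fin (g * q)) : cluster q g i.succ = g - 1 - i / q := by
    rw [cluster, Fin.val_succ, show (i : ℕ) + 1 + q - 1 = i + q by omega, Nat.add_div_right _ hq]
    omega
  rw [nodal, Fin.prod_univ_succ, mul_comm, Function.comp_apply, hzero,
    ← Finset.prod_range_reflect, ← prod_range_mul_div hq g fun a => X - C (w (g - 1 - a)),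
    ← Fin.prod_univ_eq_prod_range (fun i => X - C (w (g - 1 - i / q))) (g * q)]
  simp only [Function.comp_apply, hsucc]

theorem nodalPowQuot_congr {R ι : Type*} [CommRing R] [Fintype ι] [DecidableEq ι] {z : ι → R}
    {i j : ι} (h : z i = z j) (N : ℕ) : nodalPowQuot z N i = nodalPowQuot z N j := by
  have herase : nodal (Finset.univ.erase i) z = nodal (Finset.univ.erase j) z := by
    refine (monic_X_sub_C (z i)).isRegular.left ?_
    change (X - C (z i)) * _ = (X - C (z i)) * _
    rw [← Lagrange.nodal_eq_mul_nodal_erase (Finset.mem_univ i), h,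
      ← Lagrange.nodal_eq_mul_nodal_erase (Finset.mem_univ j)]
  rw [nodalPowQuot, nodalPowQuot, herase]

theorem solEval_congr {R : Type*} [CommRing R] {p q g s : ℕ} {z : Fin (g * q + 1) → R}
    {i j : Fin (g * q + 1)} (h : z i = z j) : solEval p q g s z i = solEval p q g s z j :=
  congrArg (coeffRow _ g) (nodalPowQuot_congr h _)

theorem exists_powerMatrix_mul_eq_mul_submatrix {R : Type*} [CommRing R] {q g : ℕ} (hq : 0 < q)
    {w : ℕ → R} (hw : w 0 = 0) {B : Matrix (Fin (g * q + 1)) (Fin g) R}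
    (hB : ∀ i j, cluster q g i = cluster q g j → B i = B j) :
    ∃ Z, powerMatrix g (w ∘ cluster q g) * B = Z * B.submatrix (minorRow q g) id := by
  let E : Matrix (Fin (g * q + 1)) (Fin g) R :=
    Matrix.of fun i c => if cluster q g i = c + 1 then 1 else 0
  refine ⟨powerMatrix g (w ∘ cluster q g) * E, ?_⟩
  rw [Matrix.mul_assoc]
  ext u l
  rw [Matrix.mul_apply, Matrix.mul_apply]
  refine Finset.sum_congr rfl fun i _ => ?_
  rcases Nat.eq_zero_or_pos (cluster q g i) with h0 | h0
  · simp [powerMatrix, h0, hw]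
  · obtain ⟨c, hc⟩ : ∃ c : Fin g, cluster q g i = c + 1 :=
      ⟨⟨cluster q g i - 1, by have : cluster q g i ≤ g := Nat.sub_le ..; omega⟩,
        (Nat.sub_add_cancel h0).symm⟩
    have hEB : (E * B.submatrix (minorRow q g) id) i l = B i l := by
      rw [hB i (minorRow q g c) (hc.trans (cluster_minorRow hq c).symm)]
      simp [E, Matrix.mul_apply, hc, Fin.val_inj]
    rw [hEB]

theorem det_powerSumMatrix_ne_zero {R : Type*} [CommRing R] [IsDomain R] {q g : ℕ}
    (h : ∀ d < g, ((q * d + 1 : ℕ) : R) ≠ 0) (z : Fin (g * q + 1) → R) :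
    (powerSumMatrix q g z).det ≠ 0 := by
  rw [det_powerSumMatrix, Fintype.card_fin]
  refine Finset.prod_ne_zero_iff.2 fun u _ => ?_
  obtain ⟨d, hd⟩ := Nat.exists_eq_add_of_lt u.2
  have hfactor : (q : R) * (u + 1) - (g * q + 1 : ℕ) = -((q * d + 1 : ℕ) : R) := by
    have hg : (g : R) = u + d + 1 := by exact_mod_cast congrArg Nat.cast hd
    push_cast
    linear_combination -(q : R) * hg
  rw [hfactor, neg_ne_zero]
  exact h d (by omega)

theorem exists_det_ne_zero_and_rowMinor_ne_zero (K : Type*) [Field K] [Infinite K] {p q g : ℕ}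
    [CharP K p] (hp : p.Prime) (hpq : p.Coprime q)
    (hdvd : ∀ d < g, ¬p ∣ q * d + 1) :
    ∃ z : Fin (g * q + 1) → K, (hasseWittEval p q g 1 z).det ≠ 0 ∧
      rowMinor q g (solEval p q g 1 z) ≠ 0 := by
  have hq := pos_of_coprime hp hpq
  obtain ⟨w, hw0, hw⟩ := exists_det_coeffMatrix_prod_mul_ne_zero K (pow_pos hp.pos (ord p q)) g
    (expo p q 1)
  have hdet : (hasseWittEval p q g 1 (w ∘ cluster q g)).det ≠ 0 := by
    rw [hasseWittEval, nodal_cluster hq, mul_pow, ← Finset.prod_pow]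
    have hexpo : q * expo p q 1 = p ^ ord p q - 1 := by
      rw [← pow_one (p ^ ord p q), ← mul_expo_add_one hp, Nat.add_sub_cancel]
    simpa only [← pow_mul, hexpo, pow_one] using hw
  have hrelation : powerSumMatrix q g (w ∘ cluster q g) * hasseWittEval p q g 1 (w ∘ cluster q g) =
      powerMatrix g (w ∘ cluster q g) * solEval p q g 1 (w ∘ cluster q g) := by
    ext u l
    simpa [sub_eq_zero] using
      pow_dvd_powerSumMatrix_mul_sub hp hpq (le_pow_ord hp hpq hdvd) 1 (w ∘ cluster q g) u l
  obtain ⟨Z, hZ⟩ := exists_powerMatrix_mul_eq_mul_submatrix hq hw0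
    fun i j hij => solEval_congr (p := p) (s := 1) (z := w ∘ cluster q g) (congrArg w hij)
  refine ⟨w ∘ cluster q g, hdet, right_ne_zero_of_mul (a := Z.det) ?_⟩
  rw [rowMinor, ← Matrix.det_mul, ← hZ, ← hrelation, Matrix.det_mul]
  refine mul_ne_zero (det_powerSumMatrix_ne_zero (fun d hd => ?_) _) hdet
  rw [Ne, CharP.cast_eq_zero_iff K p]
  exact hdvd d hd

end Nonvanishing

section AdicLimit

variable {R S : Type*} [CommRing R] [CommRing S]

theorem smodEq_span_singleton_pow_iff {d x y : R} {n : ℕ} :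
    x ≡ y [SMOD (Ideal.span {d} ^ n • ⊤ : Submodule R R)] ↔ d ^ n ∣ x - y := by
  rw [SModEq.sub_mem, smul_eq_mul, Ideal.mul_top, Ideal.span_singleton_pow,
    Ideal.mem_span_singleton]

theorem isAdicComplete_span_singleton_iff {d : R} : IsAdicComplete (Ideal.span {d}) R ↔
    (∀ x, (∀ n, d ^ n ∣ x) → x = 0) ∧
      ∀ x : ℕ → R, (∀ n, d ^ n ∣ x (n + 1) - x n) → ∃ L, ∀ n, d ^ n ∣ L - x n := by
  simp only [isAdicComplete_iff, isHausdorff_iff, isPrecomplete_iff, smodEq_span_singleton_pow_iff,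
    sub_zero]
  refine and_congr_right fun _ => forall_congr' fun x => imp_congr ?_ ?_
  · refine ⟨fun h n => (dvd_sub_comm).1 (h n.le_succ), fun h m n hmn => (dvd_sub_comm).1 ?_⟩
    exact pow_dvd_sub_of_le hmn fun k _ _ => h k
  · simp only [dvd_sub_comm]

theorem natCast_pow_dvd_mvPowerSeries_iff {ι : Type*} {n s : ℕ} {f : MvPowerSeries ι R} :
    (n : MvPowerSeries ι R) ^ s ∣ f ↔ ∀ d, (n : R) ^ s ∣ MvPowerSeries.coeff d f := by
  have hcoeff (h : MvPowerSeries ι R) (d : ι →₀ ℕ) : MvPowerSeries.coeff d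
      ((n : MvPowerSeries ι R) ^ s * h) = (n : R) ^ s * MvPowerSeries.coeff d h := by
    rw [← MvPowerSeries.coeff_C_mul, map_pow, map_natCast]
  refine ⟨?_, fun h => ?_⟩
  · rintro ⟨h, rfl⟩ d
    exact ⟨_, hcoeff h d⟩
  · choose c hc using h
    exact ⟨fun d => c d, MvPowerSeries.ext fun d => (hc d).trans (hcoeff _ d).symm⟩

theorem isAdicComplete_mvPowerSeries (ι : Type*) (n : ℕ) [IsAdicComplete (Ideal.span {(n : R)}) R] :
    IsAdicComplete (Ideal.span {(n : MvPowerSeries ι R)}) (MvPowerSeries ι R) := by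
  obtain ⟨hhaus, hprec⟩ := isAdicComplete_span_singleton_iff.1 ‹IsAdicComplete (Ideal.span {_}) R›
  simp only [isAdicComplete_span_singleton_iff, natCast_pow_dvd_mvPowerSeries_iff, map_sub]
  refine ⟨fun f hf => MvPowerSeries.ext fun d => hhaus _ fun s => hf s d, fun f hf => ?_⟩
  choose L hL using fun d => hprec (fun s => MvPowerSeries.coeff d (f s)) fun s => hf s d
  exact ⟨fun d => L d, fun s d => hL d s⟩

/-- The matrix `T` is the `p`-adic limit of the matrices `I_s * A(Φ_s)⁻¹` at the point `z`, with
the rate of convergence of Dwork's congruences. -/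
def IsDworkLimit (p q g : ℕ) (z : Fin (g * q + 1) → R)
    (T : Matrix (Fin (g * q + 1)) (Fin g) R) : Prop :=
  ∀ s i l, (p : R) ^ s ∣ T i l - approxEval p q g s z i l

variable {p q g : ℕ} {z : Fin (g * q + 1) → R} {T : Matrix (Fin (g * q + 1)) (Fin g) R}

theorem IsDworkLimit.map (φ : R →+* S)
    (hz : ∀ s, 0 < s → IsUnit (hasseWittEval p q g s z).det) (hT : IsDworkLimit p q g z T) :
    IsDworkLimit p q g (φ ∘ z) (T.map φ) := by
  intro s i l
  rcases s.eq_zero_or_pos with rfl | hs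
  · simp
  · simpa [← map_approxEval φ (hz s hs)] using map_dvd φ (hT s i l)

theorem IsDworkLimit.natCast_dvd_rowMinor_sub (hT : IsDworkLimit p q g z T) :
    (p : R) ∣ rowMinor q g T - rowMinor q g (approxEval p q g 1 z) := by
  rw [← Ideal.mem_span_singleton, ← Ideal.Quotient.eq, map_rowMinor, map_rowMinor]
  congr 1
  ext i l
  simpa [Ideal.Quotient.eq, Ideal.mem_span_singleton] using hT 1 i l

variable [IsAdicComplete (Ideal.span {(p : R)}) R]

theorem eq_of_forall_pow_dvd_sub {x y : R} (h : ∀ s, (p : R) ^ s ∣ x - y) : x = y :=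
  (IsHausdorff.eq_iff_smodEq (I := Ideal.span {(p : R)})).2 fun s =>
    smodEq_span_singleton_pow_iff.2 (h s)

section

variable (hp : p.Prime) (hpq : p.Coprime q)
include hp hpq

theorem IsDworkLimit.sum_eq_zero (hT : IsDworkLimit p q g z T) (l : Fin g) : ∑ i, T i l = 0 := by
  refine eq_of_forall_pow_dvd_sub (p := p) fun s => ?_
  have happrox : (p : R) ^ s ∣ ∑ i, approxEval p q g s z i l := by
    simp only [approxEval, Matrix.mul_apply]
    rw [Finset.sum_comm]
    refine Finset.dvd_sum fun k _ => ?_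
    rw [← Finset.sum_mul]
    exact (pow_dvd_sum_solEval hp hpq s z k).mul_right _
  rw [sub_zero, ← dvd_sub_left happrox, ← Finset.sum_sub_distrib]
  exact Finset.dvd_sum fun i _ => hT s i l

variable (hg : g ≤ p ^ ord p q)
include hg

theorem isUnit_det_hasseWittEval (hz : IsUnit (hasseWittEval p q g 1 z).det) {s : ℕ}
    (hs : 0 < s) : IsUnit (hasseWittEval p q g s z).det := by
  nontriviality R
  have hjac := IsAdicComplete.le_jacobson_bot (Ideal.span {(p : R)})
  have hunit : (p : R) ∈ nonunits R := fun h => by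
    have htop := top_le_iff.1 (Ideal.span_singleton_eq_top.2 h ▸ hjac)
    exact bot_ne_top (Ideal.jacobson_eq_top_iff.1 htop)
  have := Fact.mk hp
  have := CharP.quotient R p hunit
  have := isLocalHom_of_le_jacobson_bot _ hjac
  refine IsUnit.of_map (Ideal.Quotient.mk (Ideal.span {(p : R)})) _ ?_
  rw [RingHom.map_det, RingHom.mapMatrix_apply, map_hasseWittEval]
  refine isUnit_det_hasseWittEval_of_expChar hp hpq hg ?_ hs
  rw [← map_hasseWittEval, ← RingHom.mapMatrix_apply, ← RingHom.map_det]
  exact hz.map _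

variable (hz : IsUnit (hasseWittEval p q g 1 z).det)
include hz

theorem exists_isDworkLimit (hreg : (p : R) ∈ nonZeroDivisors R) :
    ∃ T, IsDworkLimit p q g z T := by
  choose T hT using fun i l => (isAdicComplete_span_singleton_iff.1 ‹_›).2
    (fun s => approxEval p q g s z i l) fun s =>
      pow_dvd_approxEval_succ_sub hp hpq hg hreg
        (fun s hs => isUnit_det_hasseWittEval hp hpq hg hz hs) s i l
  exact ⟨T, fun s i l => hT i l s⟩

theorem IsDworkLimit.powerMatrix_mul (hT : IsDworkLimit p q g z T) :
    powerMatrix g z * T = powerSumMatrix q g z := by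
  ext u l
  refine eq_of_forall_pow_dvd_sub (p := p) fun s => ?_
  rcases s.eq_zero_or_pos with rfl | hs
  · simp
  have hA := isUnit_det_hasseWittEval hp hpq hg hz hs
  have happrox : powerMatrix g z * T - powerSumMatrix q g z =
      powerMatrix g z * (T - approxEval p q g s z) -
        (powerSumMatrix q g z * hasseWittEval p q g s z - powerMatrix g z * solEval p q g s z) *
          (hasseWittEval p q g s z)⁻¹ := by
    rw [Matrix.sub_mul, Matrix.mul_nonsing_inv_cancel_right _ _ hA, Matrix.mul_sub, approxEval,
      Matrix.mul_assoc]
    abel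
  rw [← Matrix.sub_apply, happrox, Matrix.sub_apply, Matrix.mul_apply, Matrix.mul_apply]
  refine dvd_sub (Finset.dvd_sum fun k _ => (hT s k l).mul_left _) ?_
  exact Finset.dvd_sum fun k _ => (pow_dvd_powerSumMatrix_mul_sub hp hpq hg s z u k).mul_right _

end

end AdicLimit

section DworkLimit

variable {R : Type*} [CommRing R] {p q g : ℕ} {z : Fin (g * q + 1) → R}
  {T : Matrix (Fin (g * q + 1)) (Fin g) R} [IsAdicComplete (Ideal.span {(p : R)}) R]
  (hp : p.Prime) (hpq : p.Coprime q) (hg : g ≤ p ^ ord p q)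
  (hz : IsUnit (hasseWittEval p q g 1 z).det)

include hp hpq hg hz

theorem IsDworkLimit.linearIndependent_col_map {K : Type*} [Field K] [CharZero K]
    (hT : IsDworkLimit p q g z T) (φ : R →+* K) : LinearIndependent K (T.map φ).col := by
  have hmul : (powerMatrix g z).map φ * T.map φ = powerSumMatrix q g (φ ∘ z) := by
    rw [← Matrix.map_mul, hT.powerMatrix_mul hp hpq hg hz]
    ext u j
    simp [powerSumMatrix, apply_ite φ]
  have hunit : IsUnit ((powerMatrix g z).map φ * T.map φ) := by
    rw [Matrix.isUnit_iff_isUnit_det, hmul, isUnit_iff_ne_zero]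
    exact det_powerSumMatrix_ne_zero (fun d _ => Nat.cast_ne_zero.2 (Nat.succ_ne_zero _)) _
  rw [← Matrix.mulVec_injective_iff]
  refine Function.Injective.of_comp (f := ((powerMatrix g z).map φ).mulVec) ?_
  convert Matrix.mulVec_injective_of_isUnit hunit using 1
  ext1 x
  exact Matrix.mulVec_mulVec ..

theorem exists_isDworkLimit_mvPowerSeries [IsDomain R] (hp0 : (p : R) ≠ 0) :
    ∃ T : Matrix (Fin (g * q + 1)) (Fin g) (MvPowerSeries (Fin (g * q + 1)) R),
      IsDworkLimit p q g (fun j => MvPowerSeries.C (z j) + MvPowerSeries.X j) T ∧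
      ∀ s, 0 < s → IsUnit
        (hasseWittEval p q g s fun j => MvPowerSeries.C (z j) + MvPowerSeries.X j).det := by
  have := isAdicComplete_mvPowerSeries (R := R) (Fin (g * q + 1)) p
  have hunit : IsUnit
      (hasseWittEval p q g 1 fun j => MvPowerSeries.C (z j) + MvPowerSeries.X j).det := by
    rw [MvPowerSeries.isUnit_iff_constantCoeff, RingHom.map_det, RingHom.mapMatrix_apply,
      map_hasseWittEval]
    convert hz
    ext j
    simp
  obtain ⟨T, hT⟩ := exists_isDworkLimit hp hpq hg hunit <| mem_nonZeroDivisors_of_ne_zero fun h =>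
    hp0 (by simpa using congrArg MvPowerSeries.constantCoeff h)
  exact ⟨T, hT, fun s hs => isUnit_det_hasseWittEval hp hpq hg hunit hs⟩

end DworkLimit

section UltrametricIntegers

open scoped NormedField
open Valued (integer)

variable {K : Type*} [NontriviallyNormedField K] [IsUltrametricDist K]

theorem integer_dvd_iff_norm_le {x y : integer K} : y ∣ x ↔ ‖x‖ ≤ ‖y‖ := by
  rw [← Ideal.mem_span_singleton, ← SetLike.mem_coe,
    Valued.integer.coe_span_singleton_eq_closedBall, mem_closedBall_zero_iff]

theorem natCast_pow_dvd_integer_iff {n s : ℕ} {x : integer K} :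
    (n : integer K) ^ s ∣ x ↔ ‖(x : K)‖ ≤ ‖(n : K)‖ ^ s := by
  rw [integer_dvd_iff_norm_le, ← norm_pow]
  rfl

instance completeSpace_integer [CompleteSpace K] : CompleteSpace (integer K) :=
  (Valued.isClosed_integer K).completeSpace_coe

theorem isAdicComplete_integer [CompleteSpace K] {n : ℕ} (hn : ‖(n : K)‖ < 1) :
    IsAdicComplete (Ideal.span {(n : integer K)}) (integer K) := by
  simp only [isAdicComplete_span_singleton_iff, natCast_pow_dvd_integer_iff]
  have hpow := tendsto_pow_atTop_nhds_zero_of_lt_one (norm_nonneg (n : K)) hn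
  refine ⟨fun x hx => norm_le_zero_iff.1 (ge_of_tendsto' hpow hx), fun x hx => ?_⟩
  have hcauchy : CauchySeq x := cauchySeq_of_le_geometric _ 1 hn fun s => by
    rw [dist_comm, dist_eq_norm, one_mul]
    exact hx s
  obtain ⟨L, hL⟩ := cauchySeq_tendsto_of_complete hcauchy
  refine ⟨L, fun s => le_of_tendsto (hL.sub_const (x s)).norm ?_⟩
  filter_upwards [eventually_ge_atTop s] with t hst
  refine natCast_pow_dvd_integer_iff.1 (pow_dvd_sub_of_le hst fun k _ _ => ?_)
  exact natCast_pow_dvd_integer_iff.2 (hx k)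

instance isLinearTopology_integer : IsLinearTopology (integer K) (integer K) := by
  refine IsLinearTopology.mk_of_hasBasis (integer K) (p := fun r : ℝ => 0 < r)
    (s := fun r => NormedField.valuation.leIdeal r.toNNReal)
    (Metric.nhds_basis_closedBall.congr (fun _ => Iff.rfl) fun r hr => Set.ext fun x => ?_)
  rw [mem_closedBall_zero_iff, SetLike.mem_coe, Valuation.mem_leIdeal_iff,
    NormedField.valuation_apply, ← NNReal.coe_le_coe, Real.coe_toNNReal r hr.le]
  rfl

theorem charP_residueField {p : ℕ} (hp : p.Prime) (hp1 : ‖(p : K)‖ < 1) :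
    CharP (IsLocalRing.ResidueField (integer K)) p := by
  refine (CharP.charP_iff_prime_eq_zero hp).2 ?_
  rw [← map_natCast (IsLocalRing.residue (integer K)), IsLocalRing.residue_eq_zero_iff,
    IsLocalRing.mem_maximalIdeal, mem_nonunits_iff, Valued.integer.isUnit_iff_norm_eq_one]
  exact hp1.ne

theorem exists_continuousMultilinearMap_eq_prod_pow (K : Type*) [NontriviallyNormedField K]
    {ι : Type*} [Fintype ι] {d : ι →₀ ℕ} {N : ℕ} (hd : d.degree = N) :
    ∃ W : ContinuousMultilinearMap K (fun _ : Fin N => ι → K) K,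
      ‖W‖ ≤ 1 ∧ ∀ y, W (fun _ => y) = d.prod fun i e => y i ^ e := by
  let e : (Σ i, Fin (d i)) ≃ Fin N :=
    Fintype.equivFinOfCardEq (by simp [← hd, Finsupp.degree_eq_sum])
  refine ⟨(ContinuousMultilinearMap.mkPiAlgebra K (Fin N) K).compContinuousLinearMap
    fun j => ContinuousLinearMap.proj (e.symm j).1, ?_, fun y => ?_⟩
  · refine ContinuousMultilinearMap.opNorm_le_bound zero_le_one fun y => ?_
    simpa using Finset.prod_le_prod (fun j _ => norm_nonneg _) fun j _ => norm_le_pi_norm (y j) _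
  · simpa [Fintype.prod_sigma, Finsupp.prod_fintype] using
      e.symm.prod_comp fun x => y x.1

theorem exists_formalMultilinearSeries {ι : Type*} [Fintype ι] [DecidableEq ι]
    (f : MvPowerSeries ι (integer K)) :
    ∃ P : FormalMultilinearSeries K (ι → K) K, (∀ N, ‖P N‖ ≤ 1) ∧
      ∀ N (y : ι → K), (P N fun _ => y) = ∑ d ∈ (Finset.univ : Finset ι).finsuppAntidiag N,
        ((MvPowerSeries.coeff d f : integer K) : K) * d.prod fun i e => y i ^ e := by
  have hdeg {N : ℕ} (d : {d // d ∈ (Finset.univ : Finset ι).finsuppAntidiag N}) :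
      d.1.degree = N := by
    rw [Finsupp.degree_eq_sum]
    exact (Finset.mem_finsuppAntidiag.1 d.2).1
  choose W hWnorm hW using fun N d =>
    exists_continuousMultilinearMap_eq_prod_pow K (hdeg (N := N) d)
  refine ⟨fun N => ∑ d, ((MvPowerSeries.coeff d.1 f : integer K) : K) • W N d,
    fun N => ?_, fun N y => ?_⟩
  · refine ContinuousMultilinearMap.opNorm_le_bound zero_le_one fun y => ?_
    rw [sum_apply]
    refine IsUltrametricDist.norm_sum_le_of_forall_le_of_nonneg (by positivity)
      fun d _ => ?_
    rw [smul_apply, norm_smul]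
    exact mul_le_mul (Valued.integer.norm_le_one _)
      (by simpa using (W N d).le_of_opNorm_le (hWnorm N d) y) (norm_nonneg _) zero_le_one
  · simp only [sum_apply, smul_apply, hW, smul_eq_mul]
    exact Finset.sum_coe_sort (Finset.univ.finsuppAntidiag N) fun d : ι →₀ ℕ =>
      ((MvPowerSeries.coeff d f : integer K) : K) * d.prod fun i e => y i ^ e

theorem hasEval_of_norm_lt_one {ι : Type*} [Finite ι] {x : ι → integer K}
    (hx : ∀ i, ‖x i‖ < 1) : MvPowerSeries.HasEval x where
  hpow i := tendsto_pow_atTop_nhds_zero_of_norm_lt_one (hx i)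
  tendsto_zero := by simp [cofinite_eq_bot]

theorem exists_hasFPowerSeriesOnBall [CompleteSpace K] {ι : Type*} [Fintype ι]
    (f : MvPowerSeries ι (integer K)) {F : (ι → K) → K} {a : ι → K}
    (hF : ∀ (x : ι → integer K) (hx : ∀ i, ‖x i‖ < 1),
      F (fun i => a i + x i) = (MvPowerSeries.aeval (hasEval_of_norm_lt_one hx) f : integer K)) :
    ∃ P : FormalMultilinearSeries K (ι → K) K, HasFPowerSeriesOnBall F P a 1 := by
  classical
  obtain ⟨P, hPnorm, hP⟩ := exists_formalMultilinearSeries f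
  refine ⟨P, by simpa using P.le_radius_of_bound 1 (r := 1) fun n => by simpa using hPnorm n,
    one_pos, fun {y} hy => ?_⟩
  rw [Metric.mem_eball, edist_zero_right, ← ofReal_norm, ENNReal.ofReal_lt_one] at hy
  have hnorm (i : ι) : ‖y i‖ < 1 := (norm_le_pi_norm y i).trans_lt hy
  let x (i : ι) : integer K := ⟨y i, Valued.integer.mem_iff.2 (hnorm i).le⟩
  have hsum := ((MvPowerSeries.hasSum_aeval (R := integer K)
    (hasEval_of_norm_lt_one (x := x) hnorm) f).map (integer K).subtype
      continuous_subtype_val).tsum_fiberwise fun d : ι →₀ ℕ => d.degree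
  have hfiber (N : ℕ) : (fun d : ι →₀ ℕ => d.degree) ⁻¹' {N} =
      ↑((Finset.univ : Finset ι).finsuppAntidiag N) := by
    ext d
    simp [Finset.mem_finsuppAntidiag, Finsupp.degree_eq_sum]
  change HasSum _ (F fun i => a i + x i)
  rw [hF x hnorm]
  refine hsum.congr_fun fun N => ?_
  rw [hP, hfiber, Finset.tsum_subtype']
  refine Finset.sum_congr rfl fun d _ => ?_
  simp [Finsupp.prod, x]

end UltrametricIntegers

section Analyticity

open scoped NormedField
open Valued (integer)

variable {K : Type*} [NontriviallyNormedField K] [IsUltrametricDist K] {p q g : ℕ}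

theorem exists_hasFPowerSeriesOnBall_of_isDworkLimit [CompleteSpace K] (hp : p.Prime)
    (hpq : p.Coprime q) (hg : g ≤ p ^ ord p q) (hp0 : (p : K) ≠ 0) (hp1 : ‖(p : K)‖ < 1)
    {i : Fin (g * q + 1)} {l : Fin g} {F : (Fin (g * q + 1) → K) → K}
    (hF : ∀ (x : Fin (g * q + 1) → integer K) (T : Matrix (Fin (g * q + 1)) (Fin g) (integer K)),
      IsUnit (hasseWittEval p q g 1 x).det → IsDworkLimit p q g x T →
        F (fun j => x j) = T i l)
    {a : Fin (g * q + 1) → integer K} (ha : IsUnit (hasseWittEval p q g 1 a).det) :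
    ∃ P : FormalMultilinearSeries K (Fin (g * q + 1) → K) K,
      HasFPowerSeriesOnBall F P (fun j => a j) 1 := by
  have := isAdicComplete_integer hp1
  obtain ⟨T, hT, hunit⟩ := exists_isDworkLimit_mvPowerSeries hp hpq hg ha
    fun h => hp0 (congrArg Subtype.val h)
  refine exists_hasFPowerSeriesOnBall (T i l) fun x hx => ?_
  let ev := (MvPowerSeries.aeval (R := integer K) (hasEval_of_norm_lt_one hx)).toRingHom
  have hev : ev ∘ (fun j => MvPowerSeries.C (a j) + MvPowerSeries.X j) = a + x := by
    funext j
    have haeval := MvPowerSeries.aeval_coe (R := integer K) (hasEval_of_norm_lt_one hx)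
      (MvPolynomial.C (a j) + MvPolynomial.X j)
    rw [MvPolynomial.coe_add, MvPolynomial.coe_C, MvPolynomial.coe_X] at haeval
    refine haeval.trans ?_
    simp
  refine hF (a + x) (T.map ev) ?_ (hev ▸ hT.map ev hunit)
  rw [← hev, ← map_hasseWittEval, ← RingHom.mapMatrix_apply, ← RingHom.map_det]
  exact (hunit 1 one_pos).map ev

end Analyticity

section Points

theorem isPrimitiveRoot_map_of_natCast_ne_zero {R S : Type*} [CommRing R] [CommRing S] [IsDomain R]
    [IsDomain S] (φ : R →+* S) {n : ℕ} (hn : (n : S) ≠ 0) {ζ : R} (hζ : IsPrimitiveRoot ζ n) :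
    IsPrimitiveRoot (φ ζ) n := by
  have : NeZero (n : S) := ⟨hn⟩
  have hn0 : 0 < n := Nat.pos_of_ne_zero fun h => hn (by rw [h, Nat.cast_zero])
  rw [← Polynomial.isRoot_cyclotomic_iff, ← Polynomial.map_cyclotomic n φ]
  exact (hζ.isRoot_cyclotomic hn0).map

theorem exists_finset_card_eq_add_one {R : Type*} [CommRing R] [IsDomain R] {n : ℕ} (hn : 0 < n)
    {ζ : R} (hζ : IsPrimitiveRoot ζ n) : ∃ S : Finset R, S.card = n + 1 := by
  classical
  refine ⟨insert 0 (Polynomial.nthRootsFinset n 1), ?_⟩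
  rw [Finset.card_insert_of_notMem, hζ.card_nthRootsFinset]
  simp [Polynomial.mem_nthRootsFinset hn, hn.ne']

theorem exists_aeval_ne_zero_of_totalDegree_lt_card {R k L σ : Type*} [CommRing R] [CommRing k]
    [IsDomain k] [CommSemiring L] [Algebra R k] [Algebra R L] [Algebra k L] [IsScalarTower R k L]
    [Finite σ] {P : MvPolynomial σ R} {S : Finset k} (hS : P.totalDegree < S.card) {z : σ → L}
    (hz : MvPolynomial.aeval z P ≠ 0) : ∃ b : σ → k, MvPolynomial.aeval b P ≠ 0 := by
  contrapose! hz
  have hmap : MvPolynomial.map (algebraMap R k) P = 0 := by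
    refine MvPolynomial.eq_zero_of_eval_zero_at_prod_finset _ (fun _ => S) (fun i => ?_)
      fun x _ => by rw [MvPolynomial.eval_map, ← MvPolynomial.aeval_def, hz x]
    exact (MvPolynomial.degreeOf_le_totalDegree _ _).trans_lt
      ((Finset.sup_mono (MvPolynomial.support_map_subset _ _)).trans_lt hS)
  rw [← MvPolynomial.aeval_map_algebraMap k, hmap, map_zero]

variable {p q g : ℕ} (hp : p.Prime) (hpq : p.Coprime q)
include hp hpq

theorem aeval_det_mul_rowMinor {R : Type*} [CommRing R] [Algebra ℤ R] (z : Fin (g * q + 1) → R) :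
    MvPolynomial.aeval z ((hasseWitt p q g 1).det * rowMinor q g (solMatrix p q g 1)) =
      (hasseWittEval p q g 1 z).det * rowMinor q g (solEval p q g 1 z) := by
  rw [← map_aeval_hasseWitt, ← map_aeval_solMatrix hp hpq one_pos, map_mul, rowMinor, rowMinor,
    AlgHom.map_det, AlgHom.map_det]
  rfl

variable (hdvd : ∀ d < g, ¬p ∣ q * d + 1)
include hdvd

theorem exists_det_mul_rowMinor_ne_zero_of_lt_card {k : Type*} [Field k] [CharP k p] {S : Finset k}
    (hS : degPhi p q g + degM p q g < S.card) :
    ∃ b : Fin (g * q + 1) → k,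
      (hasseWittEval p q g 1 b).det * rowMinor q g (solEval p q g 1 b) ≠ 0 := by
  have : CharP (AlgebraicClosure k) p := charP_of_injective_algebraMap' k p
  obtain ⟨z, hdet, hminor⟩ :=
    exists_det_ne_zero_and_rowMinor_ne_zero (AlgebraicClosure k) hp hpq hdvd
  simp only [← aeval_det_mul_rowMinor hp hpq]
  refine exists_aeval_ne_zero_of_totalDegree_lt_card (L := AlgebraicClosure k) (z := z)
    ((MvPolynomial.totalDegree_mul _ _).trans_lt hS) ?_
  rw [aeval_det_mul_rowMinor hp hpq]
  exact mul_ne_zero hdet hminor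

theorem exists_injective_isUnit_det_isUnit_rowMinor {R : Type*} [CommRing R] [IsDomain R]
    [IsLocalRing R] [CharZero R] [CharP (IsLocalRing.ResidueField R) p] {n : ℕ} {ζ : R}
    (hζ : IsPrimitiveRoot ζ n) (hn : ¬p ∣ n) (hdeg : degPhi p q g + degM p q g < n + 1) :
    ∃ a : Fin (g * q + 1) → R, Function.Injective a ∧
      IsUnit (hasseWittEval p q g 1 a).det ∧ IsUnit (rowMinor q g (solEval p q g 1 a)) := by
  let ρ := IsLocalRing.residue R
  have hζρ : IsPrimitiveRoot (ρ ζ) n := by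
    refine isPrimitiveRoot_map_of_natCast_ne_zero ρ ?_ hζ
    rwa [Ne, CharP.cast_eq_zero_iff _ p]
  have hn0 : n ≠ 0 := by
    rintro rfl
    exact hn (dvd_zero p)
  obtain ⟨S, hS⟩ := exists_finset_card_eq_add_one hn0.pos hζρ
  obtain ⟨b, hb⟩ := exists_det_mul_rowMinor_ne_zero_of_lt_card hp hpq hdvd (hS ▸ hdeg)
  obtain ⟨lift, hlift⟩ := (IsLocalRing.residue_surjective (R := R)).hasRightInverse
  -- The multiples of `p` separate the coordinates without changing their residues.
  let a (i : Fin (g * q + 1)) : R := lift (b i) + p * (i : ℕ)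
  have ha : ρ ∘ a = b := funext fun i => by simpa [a, ρ] using hlift (b i)
  refine ⟨a, fun i j hij => ?_, ?_⟩
  · have hbij : b i = b j := by simp only [← ha, Function.comp_apply, hij]
    simp only [a, hbij, add_right_inj] at hij
    exact Fin.ext (Nat.cast_injective (mul_left_cancel₀ (Nat.cast_ne_zero.2 hp.ne_zero) hij))
  · rw [← IsUnit.mul_iff, ← IsLocalRing.residue_ne_zero_iff_isUnit, map_mul, map_rowMinor,
      RingHom.map_det, RingHom.mapMatrix_apply, map_hasseWittEval, map_solEval]
    rwa [← ha] at hb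

end Points

section UnramifiedField

open scoped NormedField
open Valued (integer)

variable {p q g m s : ℕ} [Fact p.Prime]

theorem norm_natCast_unr : ‖(p : Unr p m)‖ = (p : ℝ)⁻¹ := by
  rw [← map_natCast (algebraMap ℚ_[p] (Unr p m)), ← Padic.norm_p]
  exact PadicAlgCl.norm_extends p p

theorem norm_natCast_unr_lt_one : ‖(p : Unr p m)‖ < 1 := by
  rw [norm_natCast_unr]
  exact inv_lt_one_of_one_lt₀ (Nat.one_lt_cast.2 (Fact.out : p.Prime).one_lt)

theorem natCast_pow_dvd_integer_unr_iff {x : integer (Unr p m)} :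
    (p : integer (Unr p m)) ^ s ∣ x ↔ ‖(x : Unr p m)‖ ≤ (p : ℝ)⁻¹ ^ s := by
  rw [natCast_pow_dvd_integer_iff, norm_natCast_unr]

theorem finiteDimensional_unr (hm : 0 < m) : FiniteDimensional ℚ_[p] (Unr p m) := by
  have hn : 0 < p ^ m - 1 := Nat.sub_pos_of_lt (Nat.one_lt_pow hm.ne' (Fact.out : p.Prime).one_lt)
  have : Finite {ζ : PadicAlgCl p | IsPrimitiveRoot ζ (p ^ m - 1)} :=
    (Polynomial.nthRootsFinset (p ^ m - 1) (1 : PadicAlgCl p)).finite_toSet.subset fun ζ hζ =>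
      (Polynomial.mem_nthRootsFinset hn _).2 hζ.pow_eq_one
  exact IntermediateField.finiteDimensional_adjoin fun x _ => Algebra.IsIntegral.isIntegral x

theorem completeSpace_unr (hm : 0 < m) : CompleteSpace (Unr p m) :=
  have := finiteDimensional_unr (p := p) hm
  FiniteDimensional.complete ℚ_[p] (Unr p m)

theorem exists_isPrimitiveRoot_integer_unr (hm : 0 < m) :
    ∃ ζ : integer (Unr p m), IsPrimitiveRoot ζ (p ^ m - 1) := by
  have hn : p ^ m - 1 ≠ 0 :=
    (Nat.sub_pos_of_lt (Nat.one_lt_pow hm.ne' (Fact.out : p.Prime).one_lt)).ne'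
  have : NeZero (p ^ m - 1) := ⟨hn⟩
  obtain ⟨ζ, hζ⟩ := HasEnoughRootsOfUnity.exists_primitiveRoot (PadicAlgCl p) (p ^ m - 1)
  let ω : Unr p m := ⟨ζ, IntermediateField.subset_adjoin _ _ hζ⟩
  have hω : IsPrimitiveRoot ω (p ^ m - 1) :=
    IsPrimitiveRoot.of_map_of_injective (f := (unramifiedField p m).val) hζ Subtype.val_injective
  have hnorm : ‖ω‖ = 1 := by
    rw [← pow_eq_one_iff_of_nonneg (norm_nonneg _) hn, ← norm_pow, hω.pow_eq_one, norm_one]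
  exact ⟨⟨ω, Valued.integer.mem_iff.2 hnorm.le⟩, IsPrimitiveRoot.of_map_of_injective
    (f := (integer (Unr p m)).subtype) hω Subtype.val_injective⟩

theorem hasseWittAt_eq (a : Space p q g m) :
    hasseWittAt p q g m s a = hasseWittEval p q g s a :=
  map_aeval_hasseWitt p q g s a

theorem mem_domain_iff {a : Space p q g m} : a ∈ domain p q g m ↔
    ∃ b : Fin (g * q + 1) → integer (Unr p m), (fun i => (b i : Unr p m)) = a ∧
      IsUnit (hasseWittEval p q g 1 b).det := by
  have hdet (b : Fin (g * q + 1) → integer (Unr p m)) :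
      ‖(hasseWittAt p q g m 1 fun i => (b i : Unr p m)).det‖ = 1 ↔
        IsUnit (hasseWittEval p q g 1 b).det := by
    have hmap : (hasseWittEval p q g 1 fun i => (b i : Unr p m)).det =
        (integer (Unr p m)).subtype (hasseWittEval p q g 1 b).det := by
      rw [RingHom.map_det, RingHom.mapMatrix_apply, map_hasseWittEval]
      rfl
    rw [Valued.integer.isUnit_iff_norm_eq_one, hasseWittAt_eq, hmap]
    rfl
  constructor
  · rintro ⟨hint, hunit⟩
    exact ⟨fun i => ⟨a i, Valued.integer.mem_iff.2 (hint i)⟩, rfl, (hdet _).1 hunit⟩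
  · rintro ⟨b, rfl, hb⟩
    exact ⟨fun i => Valued.integer.norm_le_one (b i), (hdet b).2 hb⟩

section Limit

variable (hpq : p.Coprime q) (hg : g ≤ p ^ ord p q) (hm : 0 < m)

include hpq hg hm

theorem approxMatrix_coe (hs : 0 < s) {b : Fin (g * q + 1) → integer (Unr p m)}
    (hb : IsUnit (hasseWittEval p q g 1 b).det) :
    approxMatrix p q g m s (fun i => b i) =
      (approxEval p q g s b).map (integer (Unr p m)).subtype := by
  have := completeSpace_unr (p := p) hm
  have := isAdicComplete_integer (norm_natCast_unr_lt_one (p := p) (m := m))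
  rw [map_approxEval _ (isUnit_det_hasseWittEval Fact.out hpq hg hb hs), approxMatrix,
    hasseWittAt_eq, solMatrixAt, map_aeval_solMatrix Fact.out hpq hs]
  rfl

theorem IsDworkLimit.norm_sub_approxMatrix_le {b : Fin (g * q + 1) → integer (Unr p m)}
    (hb : IsUnit (hasseWittEval p q g 1 b).det)
    {T : Matrix (Fin (g * q + 1)) (Fin g) (integer (Unr p m))} (hT : IsDworkLimit p q g b T)
    (hs : 0 < s) (i : Fin (g * q + 1)) (l : Fin g) :
    ‖(T i l : Unr p m) - approxMatrix p q g m s (fun i => b i) i l‖ ≤ (p : ℝ)⁻¹ ^ s := by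
  rw [approxMatrix_coe hpq hg hm hs hb]
  have hnorm := natCast_pow_dvd_integer_unr_iff.1 (hT s i l)
  rwa [AddSubgroupClass.coe_sub] at hnorm

theorem IsDworkLimit.limitMatrix_eq {b : Fin (g * q + 1) → integer (Unr p m)}
    (hb : IsUnit (hasseWittEval p q g 1 b).det)
    {T : Matrix (Fin (g * q + 1)) (Fin g) (integer (Unr p m))} (hT : IsDworkLimit p q g b T) :
    limitMatrix p q g m (fun i => b i) = T.map (integer (Unr p m)).subtype := by
  ext1 i l
  refine Tendsto.limUnder_eq (tendsto_iff_norm_sub_tendsto_zero.2 ?_)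
  refine squeeze_zero' (Eventually.of_forall fun _ => norm_nonneg _) ?_
    (tendsto_pow_atTop_nhds_zero_of_lt_one (inv_nonneg.2 p.cast_nonneg)
      (norm_natCast_unr (p := p) (m := m) ▸ norm_natCast_unr_lt_one))
  filter_upwards [eventually_gt_atTop 0] with s hs
  rw [norm_sub_rev]
  exact hT.norm_sub_approxMatrix_le hpq hg hm hb hs i l

theorem exists_isDworkLimit_of_mem_domain {a : Space p q g m} (ha : a ∈ domain p q g m) :
    ∃ (b : Fin (g * q + 1) → integer (Unr p m))
      (T : Matrix (Fin (g * q + 1)) (Fin g) (integer (Unr p m))), (fun i => (b i : Unr p m)) = a ∧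
      IsUnit (hasseWittEval p q g 1 b).det ∧ IsDworkLimit p q g b T := by
  obtain ⟨b, rfl, hb⟩ := mem_domain_iff.1 ha
  have := completeSpace_unr (p := p) hm
  have := isAdicComplete_integer (norm_natCast_unr_lt_one (p := p) (m := m))
  have hp0 : (p : integer (Unr p m)) ≠ 0 := Nat.cast_ne_zero.2 (Fact.out : p.Prime).ne_zero
  obtain ⟨T, hT⟩ :=
    exists_isDworkLimit Fact.out hpq hg hb (mem_nonZeroDivisors_of_ne_zero hp0)
  exact ⟨b, T, rfl, hb, hT⟩

theorem tendstoUniformlyOn_approxMatrix (i : Fin (g * q + 1)) (l : Fin g) :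
    TendstoUniformlyOn (fun (s : ℕ) a => approxMatrix p q g m s a i l)
      (fun a => limitMatrix p q g m a i l) atTop (domain p q g m) := by
  rw [Metric.tendstoUniformlyOn_iff]
  intro ε hε
  have hpow := tendsto_pow_atTop_nhds_zero_of_lt_one (norm_nonneg (p : Unr p m))
    norm_natCast_unr_lt_one
  filter_upwards [hpow.eventually (gt_mem_nhds hε), eventually_gt_atTop 0] with s hsε hs a ha
  obtain ⟨b, T, rfl, hb, hT⟩ := exists_isDworkLimit_of_mem_domain hpq hg hm ha
  rw [norm_natCast_unr] at hsε
  rw [dist_eq_norm, hT.limitMatrix_eq hpq hg hm hb]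
  exact (hT.norm_sub_approxMatrix_le hpq hg hm hb hs i l).trans_lt hsε

theorem analyticOnPolydiscs_limitMatrix (i : Fin (g * q + 1)) (l : Fin g) :
    AnalyticOnPolydiscs (K := Unr p m) (fun a => limitMatrix p q g m a i l) (domain p q g m) := by
  intro a ha
  obtain ⟨b, rfl, hb⟩ := mem_domain_iff.1 ha
  have := completeSpace_unr (p := p) hm
  exact exists_hasFPowerSeriesOnBall_of_isDworkLimit Fact.out hpq hg
    (Nat.cast_ne_zero.2 (Fact.out : p.Prime).ne_zero) norm_natCast_unr_lt_one
    (fun x T hx hT => by rw [hT.limitMatrix_eq hpq hg hm hx]; rfl) hb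

theorem linearIndependent_col_limitMatrix {a : Space p q g m} (ha : a ∈ domain p q g m) :
    LinearIndependent (Unr p m) (limitMatrix p q g m a).col := by
  obtain ⟨b, T, rfl, hb, hT⟩ := exists_isDworkLimit_of_mem_domain hpq hg hm ha
  have := completeSpace_unr (p := p) hm
  have := isAdicComplete_integer (norm_natCast_unr_lt_one (p := p) (m := m))
  rw [hT.limitMatrix_eq hpq hg hm hb]
  exact hT.linearIndependent_col_map Fact.out hpq hg hb _

theorem distribution_le_zeroSum {a : Space p q g m} (ha : a ∈ domain p q g m) :
    distribution p q g m a ≤ zeroSum p q g m := by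
  obtain ⟨b, T, rfl, hb, hT⟩ := exists_isDworkLimit_of_mem_domain hpq hg hm ha
  have := completeSpace_unr (p := p) hm
  have := isAdicComplete_integer (norm_natCast_unr_lt_one (p := p) (m := m))
  rw [distribution, Submodule.span_le, hT.limitMatrix_eq hpq hg hm hb]
  rintro _ ⟨l, rfl⟩
  have hsum := congrArg (integer (Unr p m)).subtype (hT.sum_eq_zero Fact.out hpq l)
  rw [map_sum, map_zero] at hsum
  exact hsum

theorem isAnalyticBundle_distribution :
    IsAnalyticBundle (zeroSum p q g m) (domainO p q g m) (distribution p q g m) g where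
  le _ ha := distribution_le_zeroSum hpq hg hm ha.1
  rank a ha := by
    rw [distribution, finrank_span_eq_card (linearIndependent_col_limitMatrix hpq hg hm ha.1),
      Fintype.card_fin]
  frame a ha := by
    have := completeSpace_unr (p := p) hm
    refine ⟨Metric.eball a 1, Metric.isOpen_eball, Metric.mem_eball_self one_pos,
      fun l b => (limitMatrix p q g m b).col l, fun l b hb => AnalyticAt.pi fun i => ?_,
      fun b hb => ⟨linearIndependent_col_limitMatrix hpq hg hm hb.2.1, rfl⟩⟩
    obtain ⟨P, hP⟩ := analyticOnPolydiscs_limitMatrix hpq hg hm i l a ha.1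
    exact hP.analyticOnNhd b hb

theorem norm_rowMinor_limitMatrix_sub_le {a : Space p q g m} (ha : a ∈ domain p q g m) :
    ‖rowMinor q g (limitMatrix p q g m a) - rowMinor q g (approxMatrix p q g m 1 a)‖ ≤
      (p : ℝ)⁻¹ := by
  obtain ⟨b, T, rfl, hb, hT⟩ := exists_isDworkLimit_of_mem_domain hpq hg hm ha
  have hdvd := hT.natCast_dvd_rowMinor_sub
  rw [← pow_one (p : integer (Unr p m)), natCast_pow_dvd_integer_unr_iff, pow_one] at hdvd
  rw [hT.limitMatrix_eq hpq hg hm hb, approxMatrix_coe hpq hg hm one_pos hb, ← map_rowMinor,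
    ← map_rowMinor]
  exact hdvd

omit hg in
theorem exists_norm_rowMinor_limitMatrix_eq_one (hdvd : ∀ d < g, ¬p ∣ q * d + 1)
    (hdeg : degPhi p q g + degM p q g < p ^ m) :
    ∃ a ∈ domainO p q g m, ‖rowMinor q g (limitMatrix p q g m a)‖ = 1 := by
  have hg := le_pow_ord Fact.out hpq hdvd
  have := charP_residueField (Fact.out : p.Prime) (norm_natCast_unr_lt_one (p := p) (m := m))
  have hpow : p ^ m - 1 + 1 = p ^ m := Nat.sub_add_cancel (NeZero.one_le)
  have hn : ¬p ∣ p ^ m - 1 := fun h =>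
    (Fact.out : p.Prime).not_dvd_one <| (Nat.dvd_add_right h).1 (hpow ▸ dvd_pow_self p hm.ne')
  obtain ⟨ζ, hζ⟩ := exists_isPrimitiveRoot_integer_unr (p := p) hm
  obtain ⟨b, hinj, hdet, hminor⟩ := exists_injective_isUnit_det_isUnit_rowMinor Fact.out hpq
    hdvd hζ hn (hpow.symm ▸ hdeg)
  have ha : (fun i => (b i : Unr p m)) ∈ domain p q g m := mem_domain_iff.2 ⟨b, rfl, hdet⟩
  refine ⟨_, ⟨ha, fun i j hij h => hij (hinj (Subtype.ext h))⟩, ?_⟩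
  have happrox : ‖rowMinor q g (approxMatrix p q g m 1 fun i => b i)‖ = 1 := by
    rw [approxMatrix_coe hpq hg hm one_pos hdet, ← map_rowMinor]
    refine Valued.integer.isUnit_iff_norm_eq_one (K := Unr p m).1 ?_
    rw [approxEval, rowMinor_mul]
    exact hminor.mul (Matrix.isUnit_nonsing_inv_det_iff.2 hdet)
  have hclose := (norm_rowMinor_limitMatrix_sub_le hpq hg hm ha).trans_lt
    (norm_natCast_unr (p := p) (m := m) ▸ norm_natCast_unr_lt_one)
  rw [← norm_neg] at happrox
  rw [sub_eq_add_neg, ← happrox] at hclose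
  exact happrox ▸ IsUltrametricDist.norm_eq_of_add_norm_lt_max (lt_max_of_lt_right hclose)

end Limit

end UnramifiedField

end PadicKZ

end

theorem mainTheorem1_general (p q g m : ℕ) [Fact p.Prime] (hpq : p.Coprime q)
    (hdvd : ∀ d < g, ¬p ∣ q * d + 1) (hm : 0 < m)
    (hdeg : PadicKZ.degPhi p q g + PadicKZ.degM p q g < p ^ m) :
    (∀ i l, TendstoUniformlyOn (fun (s : ℕ) a => PadicKZ.approxMatrix p q g m s a i l)
      (fun a => PadicKZ.limitMatrix p q g m a i l) Filter.atTop (PadicKZ.domain p q g m)) ∧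
    (∀ i l, PadicKZ.AnalyticOnPolydiscs (K := PadicKZ.Unr p m)
      (fun a => PadicKZ.limitMatrix p q g m a i l) (PadicKZ.domain p q g m)) ∧
    PadicKZ.IsAnalyticBundle (PadicKZ.zeroSum p q g m) (PadicKZ.domainO p q g m)
      (PadicKZ.distribution p q g m) g ∧
    (∀ a ∈ PadicKZ.domain p q g m,
      ‖PadicKZ.rowMinor q g (PadicKZ.limitMatrix p q g m a) -
        PadicKZ.rowMinor q g (PadicKZ.approxMatrix p q g m 1 a)‖ ≤ (p : ℝ)⁻¹) ∧
    (∃ a ∈ PadicKZ.domainO p q g m,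
      ‖PadicKZ.rowMinor q g (PadicKZ.limitMatrix p q g m a)‖ = 1) := by
  have hg : g ≤ p ^ PadicKZ.ord p q := PadicKZ.le_pow_ord Fact.out hpq hdvd
  exact ⟨PadicKZ.tendstoUniformlyOn_approxMatrix hpq hg hm,
    PadicKZ.analyticOnPolydiscs_limitMatrix hpq hg hm,
    PadicKZ.isAnalyticBundle_distribution hpq hg hm,
    fun _ ha => PadicKZ.norm_rowMinor_limitMatrix_sub_le hpq hg hm ha,
    PadicKZ.exists_norm_rowMinor_limitMatrix_eq_one hpq hm hdvd hdeg⟩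

theorem mainTheorem1 (p q g m : ℕ) [Fact p.Prime] (hq : q.Prime) (hqp : q < p) (hg : 0 < g)
    (hpe : g * q + 1 < p ^ PadicKZ.ord p q) (hp : (g * q + 1) + q ≤ p + 2) (hm : 0 < m)
    (hdeg : PadicKZ.degPhi p q g + PadicKZ.degM p q g < p ^ m) :
    -- the limit matrix exists, uniformly on the domain, and is analytic there
    (∀ i l, TendstoUniformlyOn (fun (s : ℕ) a => PadicKZ.approxMatrix p q g m s a i l)
      (fun a => PadicKZ.limitMatrix p q g m a i l) Filter.atTop (PadicKZ.domain p q g m)) ∧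
    (∀ i l, PadicKZ.AnalyticOnPolydiscs (K := PadicKZ.Unr p m)
      (fun a => PadicKZ.limitMatrix p q g m a i l) (PadicKZ.domain p q g m)) ∧
    -- the spans of its columns form an analytic vector bundle of rank `g`
    PadicKZ.IsAnalyticBundle (PadicKZ.zeroSum p q g m) (PadicKZ.domainO p q g m)
      (PadicKZ.distribution p q g m) g ∧
    -- the distinguished minor of the limit matrix modulo `p`
    (∀ a ∈ PadicKZ.domain p q g m,
      ‖PadicKZ.rowMinor q g (PadicKZ.limitMatrix p q g m a) -
        PadicKZ.rowMinor q g (PadicKZ.approxMatrix p q g m 1 a)‖ ≤ (p : ℝ)⁻¹) ∧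
    -- this minor is not identically zero modulo `p`; in particular the domain is nonempty
    (∃ a ∈ PadicKZ.domainO p q g m,
      ‖PadicKZ.rowMinor q g (PadicKZ.limitMatrix p q g m a)‖ = 1) := by
  refine mainTheorem1_general p q g m ((Nat.coprime_primes Fact.out hq).2 hqp.ne') ?_ hm hdeg
  intro d hd hdvd
  have hle : p ≤ q * d + 1 := Nat.le_of_dvd (Nat.succ_pos _) hdvd
  have hdg : q * (d + 1) ≤ q * g := Nat.mul_le_mul_left q hd
  have hq2 := hq.two_le
  nlinarith
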